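/- Let $n\ge 1$, let $\Delta^n=\{z\in\mathbb C^n: |z_i|<1 \text{ for all } i\}$, and let $\varphi:\Delta^n\to[-\infty,+\infty)$ be a plurisubharmonic function (the constant $-\infty$ is allowed) that is toric, i.e. $\varphi(z)$ depends only on $|z_1|,\dots,|z_n|$. Use the conventions $1/0=+\infty$ and $1/{+\infty}=0$ in $[0,+\infty]$. For a measure $\mu$ near $0$ let $c_\mu(\varphi)=\sup\{c\ge 0: e^{-2c\varphi}\in L^1(\mu)\text{ on a neighbourhood of }0\}\in[0,+\infty]$. Write $\|z\|$ for the Euclidean norm and $dV$ for Lebesgue measure on $\mathbb C^n$. For $1\le k\le n$ let $c_k(\varphi)$ be the supremum, over all $k$-dimensional complex linear subspaces $H\subseteq\mathbb C^n$, of the log canonical threshold at $0$ of $\varphi|_H$, i.e. of $\sup\{c\ge 0: e^{-2c\varphi|_H}\in L^1\text{ near }0\text{ for Lebesgue measure on }H\}$. For $x\in(0,\infty)^n$ let $$\nu_\varphi(x)=\lim_{s\to-\infty}\frac{\max\{\varphi(z): |z_1|=e^{sx_1},\dots,|z_n|=e^{sx_n}\}}{s}$$ be Kiselman's refined Lelong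 number. For $x\in[0,\infty)^n$ with some $x_i=0$ let $\nu_\varphi(x)=\limsup_{y\to x,\ y\in(0,\infty)^n}\nu_\varphi(y)$. For $x\in[0,\infty)^n\setminus\{0\}$ let $$h_\varphi(x)=\inf\Big\{\frac1{\nu_\varphi(a)}: a\in[0,\infty)^n,\ \sum_{i=1}^n a_ix_i=1\Big\}.$$ Let $S=\{x\in[0,\infty)^n:\sum_i x_i=1\}$. Then: (0) The limit defining $\nu_\varphi(x)$ exists in $[0,+\infty]$ for every $x\in(0,\infty)^n$, and $\nu_\varphi:[0,\infty)^n\to[0,+\infty]$ is continuous. (1) For every real $t$ with $-n<t<0$, with the minimum and the maximum attained, $$c_{\|z\|^{2t}dV}(\varphi)=\min_{x\in S}\frac{1+t\min_{1\le i\le n}x_i}{\nu_\varphi(x)}=\max_{x\in S}\,h_\varphi(x)\,\min\Big[t+n,\ \frac1{\max_{1\le i\le n}x_i}\Big].$$ (2) For every integer $k$ with $1\le k\le n$, with the minimum and the maximum attained, $$c_k(\varphi)=\min_{x\in S}\frac{1+(k-n)\min_{1\le i\le n}x_i}{\nu_\varphi(x)}=\max_{x\in S}\,h_\varphi(x)\,\min\Big[k,\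 \frac1{\max_{1\le i\le n}x_i}\Big].$$ -/

import Mathlib

open MeasureTheory Filter Topology
open scoped ENNReal

namespace ToricPSH

/-- The open unit polydisc `Δⁿ` in `ℂⁿ`. -/
def polydisc (n : ℕ) : Set (Fin n → ℂ) := {z | ∀ i, ‖z i‖ < 1}

/-- The integral over `(0, 2π]` of an extended-real function: the integral of its positive part
minus the integral of its negative part. It is used only for functions that are bounded above, so
that the difference never has the form `∞ - ∞`. -/
noncomputable def circleIntegralEReal (f : ℝ → EReal) : EReal :=
  ((∫⁻ θ in Set.Ioc 0 (2 * Real.pi), (f θ).toENNReal : ℝ≥0∞) : EReal) -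
    ((∫⁻ θ in Set.Ioc 0 (2 * Real.pi), (-f θ).toENNReal : ℝ≥0∞) : EReal)

/-- Plurisubharmonic functions on an open set `Ω ⊆ ℂⁿ`, with values in `[-∞, +∞)`: upper
semicontinuous functions that satisfy the sub-mean value inequality on the boundary of every closed
disc `{a + ζ b : |ζ| ≤ 1} ⊆ Ω` of a complex line. The constant `-∞` is allowed. Only the values of
`φ` on `Ω` matter. -/
structure IsPlurisubharmonicOn {n : ℕ} (φ : (Fin n → ℂ) → EReal) (Ω : Set (Fin n → ℂ)) : Prop where
  lt_top : ∀ z ∈ Ω, φ z < ⊤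
  usc : UpperSemicontinuousOn φ Ω
  sub_mean : ∀ a b : Fin n → ℂ, (∀ ζ : ℂ, ‖ζ‖ ≤ 1 → a + ζ • b ∈ Ω) →
    ((2 * Real.pi : ℝ) : EReal) * φ a ≤
      circleIntegralEReal fun θ => φ (a + Complex.exp (θ * Complex.I) • b)

/-- `φ` depends only on `|z₁|, …, |zₙ|` on the polydisc. -/
def IsToric {n : ℕ} (φ : (Fin n → ℂ) → EReal) : Prop :=
  ∀ z ∈ polydisc n, ∀ w ∈ polydisc n, (∀ i, ‖z i‖ = ‖w i‖) → φ z = φ w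

/-- The weighted log canonical threshold at `0`,
`c_μ(φ) = sup {c ≥ 0 : e^{-2cφ} is L¹(μ) on a neighbourhood of 0} ∈ [0, ∞]`
(for `φ` measurable near `0`). -/
noncomputable def weightedLCT {E : Type*} [TopologicalSpace E] [Zero E] [MeasurableSpace E]
    (μ : Measure E) (φ : E → EReal) : ℝ≥0∞ :=
  sSup {C : ℝ≥0∞ | ∃ c : ℝ, 0 ≤ c ∧ C = ENNReal.ofReal c ∧
    ∃ U ∈ 𝓝 (0 : E), ∫⁻ z in U, EReal.exp (((-2 * c : ℝ) : EReal) * φ z) ∂μ < ∞}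

/-- The measure `‖z‖^{2t} dV` on `ℂⁿ`, where `‖z‖` is the Euclidean norm. -/
noncomputable def normWeight (n : ℕ) (t : ℝ) : Measure (Fin n → ℂ) :=
  volume.withDensity fun z => ENNReal.ofReal (∑ i, ‖z i‖ ^ 2) ^ t

/-- `c_k(φ)`: the supremum of the log canonical thresholds at `0` of the restrictions of `φ` to the
`k`-dimensional linear subspaces `H` of `ℂⁿ`. A subspace `H` is given as the range of an injective
linear map `L : ℂᵏ → ℂⁿ`; the threshold of `φ ∘ L` does not depend on the choice of `L`, as a linear
isomorphism multiplies Lebesgue measure by a constant. -/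
noncomputable def restrictedLCT {n : ℕ} (k : ℕ) (φ : (Fin n → ℂ) → EReal) : ℝ≥0∞ :=
  ⨆ (L : (Fin k → ℂ) →ₗ[ℂ] (Fin n → ℂ)) (_ : Function.Injective L),
    weightedLCT (volume : Measure (Fin k → ℂ)) (fun w => φ (L w))

/-- `max {φ(z) : |z₁| = e^{s x₁}, …, |zₙ| = e^{s xₙ}} / s`. -/
noncomputable def kiselmanQuotient {n : ℕ} (φ : (Fin n → ℂ) → EReal) (x : Fin n → ℝ) (s : ℝ) :
    EReal :=
  sSup (φ '' {z | ∀ i, ‖z i‖ = Real.exp (s * x i)}) / (s : EReal)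

/-- The limit of `kiselmanQuotient φ x s` as `s → -∞`, written as an upper limit. It is meaningful
when all `xᵢ` are positive: only then do the tori lie in the polydisc. -/
noncomputable def kiselmanInterior {n : ℕ} (φ : (Fin n → ℂ) → EReal) (x : Fin n → ℝ) : ℝ≥0∞ :=
  (limsup (kiselmanQuotient φ x) atBot).toENNReal

open Classical in
/-- Kiselman's refined Lelong number `ν_φ(x)`, for `x ∈ [0, ∞)ⁿ`: the limit above if all `xᵢ` are
positive, and its continuous extension (written as an upper limit) if some `xᵢ` vanishes. -/
noncomputable def refinedLelong {n : ℕ} (φ : (Fin n → ℂ) → EReal) (x : Fin n → ℝ) : ℝ≥0∞ :=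
  if ∀ i, 0 < x i then kiselmanInterior φ x
  else limsup (kiselmanInterior φ) (𝓝[{y | ∀ i, 0 < y i}] x)

/-- The dual function `h_φ(x) = inf {1 / ν_φ(a) : a ∈ [0, ∞)ⁿ, ∑ aᵢ xᵢ = 1}`, with `1 / 0 = ∞` and
`1 / ∞ = 0`. -/
noncomputable def dualLelong {n : ℕ} (φ : (Fin n → ℂ) → EReal) (x : Fin n → ℝ) : ℝ≥0∞ :=
  ⨅ (a : Fin n → ℝ) (_ : (∀ i, 0 ≤ a i) ∧ ∑ i, a i * x i = 1), (refinedLelong φ a)⁻¹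

end ToricPSH

/-! In the coordinates `u = log |z|` a toric plurisubharmonic function is, off the coordinate
hyperplanes, either identically `-∞` or a convex nondecreasing function on the negative orthant.
Convexity needs no smoothing. If it failed, subtracting a suitable quadratic function and maximizing
would produce a point where `φ` is touched from above by a function strictly concave in one
direction `v`. The sub-mean inequality on the small disc `ζ ↦ exp (u j) * (1 + ε * v j * ζ)` forbids
this (`not_touched_by_concave`, `segment_le`). Hence slopes along rays exist. The resulting `ν` is
monotone, homogeneous and superadditive on the open orthant, which is enough for a continuous
extension to the closed one.

Both threshold formulas have the same shape, with `T = t + n` or `T = k`. The sublinear function `ψ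
x = ∑ xᵢ + (T - n) min xᵢ` (`weightGauge`) equals the numerator on the simplex, and the claim is
that the threshold is the minimum of `ψ / ν`.

Upper bound: for `a < ν x` and large `r`, `φ ≤ -a r` on the polydisc with radii `exp (-r xᵢ)`, which
has measure at least a constant times `exp (-2 r ψ x)`. Integrability of `exp (-2 c φ)` then forces
`c a ≤ ψ x`. On a subspace, enough volume is obtained by taking as coordinates `k` independent rows
of maximal total weight (`exists_dominating_rows`).

Lower bound: if `c ν < ψ` on the simplex, compactness gives a uniform gap, so near `0` one has `exp
(-2 c φ) ≤ ∏ |zᵢ| ^ (-α) * |z_{i₀}| ^ (2 (n - T))` with `α < 2` and `z_{i₀}` a coordinate of largest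
modulus (`exists_exp_le`). The last factor compensates the weight `‖z‖ ^ (2t)`. On the Vandermonde
subspace at most `k` coordinates are small compared with the point, and the last factor absorbs the
other `n - k` (`exists_prod_le`).

The maximum formula is Hahn-Banach duality: between `(min ψ / ν) * ν` and `ψ` lies a linear form,
and its normalized coefficient vector is the maximizer (`exists_linearMap_between`,
`exists_le_dualLelong_mul`). -/

namespace ToricPSH

/-! ### Circle integrals and the expansion of `log |1 + a ζ|` -/

/-- The point of `ℂⁿ` with positive real coordinates `exp (uᵢ)`. -/
noncomputable def expPoint {n : ℕ} (u : Fin n → ℝ) : Fin n → ℂ := fun i => (Real.exp (u i) : ℂ)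

lemma norm_expPoint {n : ℕ} (u : Fin n → ℝ) (i : Fin n) : ‖expPoint u i‖ = Real.exp (u i) := by
  simp [expPoint, Complex.norm_exp]

lemma expPoint_mem {n : ℕ} {u : Fin n → ℝ} (hu : ∀ i, u i < 0) : expPoint u ∈ polydisc n := by
  intro i
  rw [norm_expPoint]
  exact Real.exp_lt_one_iff.2 (hu i)

lemma continuous_expPoint {n : ℕ} : Continuous (expPoint (n := n)) := by
  unfold expPoint
  fun_prop

lemma circleIntegralEReal_mono {f g : ℝ → EReal} (h : ∀ θ, f θ ≤ g θ) :
    circleIntegralEReal f ≤ circleIntegralEReal g := by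
  unfold circleIntegralEReal
  refine EReal.sub_le_sub ?_ ?_
  · exact EReal.coe_ennreal_le_coe_ennreal_iff.2
      (lintegral_mono fun θ => EReal.toENNReal_le_toENNReal (h θ))
  · exact EReal.coe_ennreal_le_coe_ennreal_iff.2
      (lintegral_mono fun θ => EReal.toENNReal_le_toENNReal (EReal.neg_le_neg_iff.2 (h θ)))

lemma circleIntegralEReal_coe {f : ℝ → ℝ} (hf : Continuous f) :
    circleIntegralEReal (fun θ => (f θ : EReal)) =
      ((∫ θ in (0 : ℝ)..(2 * Real.pi), f θ : ℝ) : EReal) := by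
  have hint : IntegrableOn f (Set.Ioc 0 (2 * Real.pi)) :=
    (hf.integrableOn_Icc).mono_set Set.Ioc_subset_Icc_self
  have h2 : ∀ θ, (-(f θ : EReal)).toENNReal = ENNReal.ofReal (-f θ) := fun θ => by
    rw [← EReal.coe_neg, EReal.toENNReal_of_ne_top (EReal.coe_ne_top _), EReal.toReal_coe]
  have h1 : ∀ θ, ((f θ : EReal)).toENNReal = ENNReal.ofReal (f θ) := fun θ => by
    rw [EReal.toENNReal_of_ne_top (EReal.coe_ne_top _), EReal.toReal_coe]
  unfold circleIntegralEReal
  simp only [h1, h2]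
  rw [intervalIntegral.integral_of_le (by positivity),
    integral_eq_lintegral_pos_part_sub_lintegral_neg_part hint, EReal.coe_sub]
  have hp : ∫⁻ θ in Set.Ioc 0 (2 * Real.pi), ENNReal.ofReal (f θ) ≠ ⊤ :=
    hint.lintegral_lt_top.ne
  have hn : ∫⁻ θ in Set.Ioc 0 (2 * Real.pi), ENNReal.ofReal (-f θ) ≠ ⊤ :=
    hint.neg.lintegral_lt_top.ne
  rw [EReal.coe_ennreal_toReal hp, EReal.coe_ennreal_toReal hn]

lemma circleIntegralEReal_bot : circleIntegralEReal (fun _ => ⊥) = ⊥ := by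
  have : (2 * Real.pi : ℝ) ≠ 0 := by positivity
  simp [circleIntegralEReal, ENNReal.top_mul, Real.pi_pos]

/-- The mean over the circle of `log |e^{iθ} + a|` vanishes for `|a| ≤ 1`. -/
lemma integral_log_norm_exp_add {a : ℝ} (ha : |a| ≤ 1) :
    ∫ θ in (0 : ℝ)..(2 * Real.pi), Real.log ‖Complex.exp (θ * Complex.I) + a‖ = 0 := by
  have h := circleAverage_log_norm_add_const_eq_posLog (a := (a : ℂ))
  rw [Real.posLog_eq_zero_iff _ |>.2 (by simpa using ha), Real.circleAverage_def] at h
  simpa [circleMap, Real.pi_ne_zero] using h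

lemma norm_one_add_mul_exp (a θ : ℝ) :
    ‖1 + (a : ℂ) * Complex.exp (θ * Complex.I)‖ = ‖Complex.exp (θ * Complex.I) + a‖ := by
  have h : Complex.exp (θ * Complex.I) * (starRingEnd ℂ) (Complex.exp (θ * Complex.I) + a)
      = 1 + a * Complex.exp (θ * Complex.I) := by
    rw [map_add, mul_add, Complex.mul_conj, Complex.normSq_eq_norm_sq,
      Complex.norm_exp_ofReal_mul_I]
    simp [mul_comm]
  rw [← h, norm_mul, Complex.norm_exp_ofReal_mul_I, one_mul, Complex.norm_conj]

/-- This is the Taylor remainder of `Re log (1 + z)` at `z = a * exp (iθ)`. Together with the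
vanishing mean above, it makes a small disc look like a segment in logarithmic coordinates up to a
mean-zero error of second order. -/
lemma abs_log_norm_sub_le {a θ : ℝ} (ha : |a| ≤ 1 / 2) :
    |Real.log ‖Complex.exp (θ * Complex.I) + a‖ - a * Real.cos θ| ≤ a ^ 2 := by
  set z : ℂ := (a : ℂ) * Complex.exp (θ * Complex.I) with hz
  have hzn : ‖z‖ = |a| := by
    rw [hz, norm_mul, Complex.norm_exp_ofReal_mul_I, mul_one, Complex.norm_real, Real.norm_eq_abs]
  have hre : z.re = a * Real.cos θ := by
    simp [hz, Complex.exp_ofReal_mul_I_re, Complex.exp_ofReal_mul_I_im]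
  rw [← norm_one_add_mul_exp, ← hz, ← hre, ← Complex.log_re, ← Complex.sub_re]
  refine (Complex.abs_re_le_norm _).trans ?_
  refine (Complex.norm_log_one_add_sub_self_le (by rw [hzn]; linarith)).trans ?_
  rw [hzn, sq_abs]
  have : (1 - |a|)⁻¹ ≤ 2 := by
    rw [inv_le_comm₀ (by linarith) (by norm_num)]
    linarith
  nlinarith [sq_nonneg a]

/-! ### The sub-mean inequality in logarithmic coordinates -/

section

variable {n : ℕ} {φ : (Fin n → ℂ) → EReal}

lemma IsToric.apply_eq_expPoint (hT : IsToric φ) {z : Fin n → ℂ} {u : Fin n → ℝ}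
    (hu : ∀ i, u i < 0) (hz : ∀ i, ‖z i‖ = Real.exp (u i)) : φ z = φ (expPoint u) := by
  refine hT z (fun i => ?_) _ (expPoint_mem hu) fun i => ?_
  · rw [hz i]
    exact Real.exp_lt_one_iff.2 (hu i)
  · rw [hz, norm_expPoint]

/-- In logarithmic coordinates, a toric plurisubharmonic function cannot be touched from above by a
quadratic function that is strictly concave in some direction. -/
lemma not_touched_by_concave (hφ : IsPlurisubharmonicOn φ (polydisc n)) (hT : IsToric φ)
    {u v c : Fin n → ℝ} (hu : ∀ i, u i < 0) {g₀ κ δ M η : ℝ} (hg : φ (expPoint u) = g₀)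
    (hδ : 0 < δ) (hM : 0 ≤ M) (hη : 0 < η)
    (htouch : ∀ t : ℝ, |t| < η → ∀ ρ : Fin n → ℝ, (∀ j, |ρ j| < η) → (∀ j, (u + t • v + ρ) j < 0) →
      φ (expPoint (u + t • v + ρ)) ≤
        ((g₀ + (κ * t - δ * t ^ 2 + ∑ j, (c j * ρ j + M * ρ j ^ 2)) : ℝ) : EReal)) : False := by
  -- The last condition is the decisive one: the error `M * ε ^ 4 * ∑ v j ^ 4` must be smaller than
  -- `δ * ε ^ 2 / 2`, the mean of `δ * (ε cos θ) ^ 2`. The others keep the disc in the polydisc and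
  -- its boundary in the range of `htouch`.
  have hε : ∀ᶠ ε : ℝ in 𝓝[>] 0, 0 < ε ∧ ε < η ∧ (∀ j, |ε * v j| < 1 / 2) ∧
      (∀ j, (ε * v j) ^ 2 < η) ∧ (∀ j, Real.exp (u j) * (1 + |ε * v j|) < 1) ∧
      M * (ε ^ 2 * ∑ j, v j ^ 4) < δ / 2 := by
    refine (eventually_mem_nhdsWithin).and (Filter.Eventually.filter_mono nhdsWithin_le_nhds ?_)
    refine (eventually_lt_nhds hη).and (Eventually.and ?_ (Eventually.and ?_ (Eventually.and ?_ ?_)))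
    · refine eventually_all.2 fun j => ?_
      have : ContinuousAt (fun ε : ℝ => |ε * v j|) 0 := by fun_prop
      exact this.eventually_lt continuousAt_const (by simp)
    · refine eventually_all.2 fun j => ?_
      have : ContinuousAt (fun ε : ℝ => (ε * v j) ^ 2) 0 := by fun_prop
      exact this.eventually_lt continuousAt_const (by simpa using hη)
    · refine eventually_all.2 fun j => ?_
      have : ContinuousAt (fun ε : ℝ => Real.exp (u j) * (1 + |ε * v j|)) 0 := by fun_prop
      exact this.eventually_lt continuousAt_const (by simpa using hu j)
    · have : ContinuousAt (fun ε : ℝ => M * (ε ^ 2 * ∑ j, v j ^ 4)) 0 := by fun_prop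
      exact this.eventually_lt continuousAt_const (by simpa using hδ)
  obtain ⟨ε, hε0, hεη, hv, hv2, hexp, hMε⟩ := hε.exists
  set ℓ : Fin n → ℝ → ℝ := fun j θ => Real.log ‖Complex.exp (θ * Complex.I) + (ε * v j : ℝ)‖ with hℓ
  have hpos : ∀ j (θ : ℝ), 0 < ‖Complex.exp (θ * Complex.I) + (ε * v j : ℝ)‖ := fun j θ => by
    have h1 := norm_sub_le_norm_add (Complex.exp (θ * Complex.I)) ((ε * v j : ℝ) : ℂ)
    have h2 := norm_sub_norm_le (Complex.exp (θ * Complex.I)) (-((ε * v j : ℝ) : ℂ))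
    rw [Complex.norm_exp_ofReal_mul_I, norm_neg, Complex.norm_real, Real.norm_eq_abs,
      sub_neg_eq_add] at h2
    have := hv j
    linarith
  have hcont : ∀ j, Continuous (ℓ j) := fun j =>
    Continuous.log (by fun_prop) fun θ => (hpos j θ).ne'
  -- The deviation of the logarithmic image of the circle from the line through `u` in direction
  -- `v`. It has mean zero, so the linear terms `c j * ρ j` disappear after integration.
  set ρ : ℝ → Fin n → ℝ := fun θ j => ℓ j θ - ε * v j * Real.cos θ with hρ
  have hρc : ∀ j, Continuous fun θ => ρ θ j := fun j => by
    have := hcont j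
    simp only [hρ]
    fun_prop
  have hρb : ∀ θ j, |ρ θ j| ≤ (ε * v j) ^ 2 := fun θ j => abs_log_norm_sub_le (hv j).le
  have hρint : ∀ j, ∫ θ in (0 : ℝ)..(2 * Real.pi), ρ θ j = 0 := fun j => by
    simp only [hρ]
    rw [intervalIntegral.integral_sub ((hcont j).intervalIntegrable _ _)
      (Continuous.intervalIntegrable (by fun_prop) _ _), intervalIntegral.integral_const_mul,
      integral_cos]
    have := integral_log_norm_exp_add (a := ε * v j) (by linarith [hv j])
    simp only [hℓ]
    rw [this]
    simp
  -- The `j`-th coordinate on the disc is `exp (u j) * (1 + ε * v j * ζ)`; for `|ζ| = 1` the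
  -- logarithm of its modulus is `u j + ℓ j θ`.
  set b : Fin n → ℂ := fun j => (ε * v j : ℝ) * expPoint u j with hb
  have hnorm : ∀ (θ : ℝ) j, ‖(expPoint u + Complex.exp (θ * Complex.I) • b) j‖ =
      Real.exp ((u + (ε * Real.cos θ) • v + ρ θ) j) := fun θ j => by
    have h1 : (expPoint u + Complex.exp (θ * Complex.I) • b) j =
        expPoint u j * (1 + ((ε * v j : ℝ) : ℂ) * Complex.exp (θ * Complex.I)) := by
      simp only [hb, Pi.add_apply, Pi.smul_apply, smul_eq_mul]
      ring
    have h2 : (u + (ε * Real.cos θ) • v + ρ θ) j = u j + ℓ j θ := by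
      simp only [hρ, Pi.add_apply, Pi.smul_apply, smul_eq_mul]
      ring
    rw [h1, norm_mul, norm_expPoint, norm_one_add_mul_exp, h2, Real.exp_add,
      Real.exp_log (hpos j θ)]
  have hdisc : ∀ ζ : ℂ, ‖ζ‖ ≤ 1 → expPoint u + ζ • b ∈ polydisc n := fun ζ hζ j => by
    have h1 : (expPoint u + ζ • b) j = expPoint u j * (1 + ((ε * v j : ℝ) : ℂ) * ζ) := by
      simp only [hb, Pi.add_apply, Pi.smul_apply, smul_eq_mul]
      ring
    rw [h1, norm_mul, norm_expPoint]
    refine lt_of_le_of_lt ?_ (hexp j)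
    gcongr
    refine (norm_add_le _ _).trans ?_
    rw [norm_one, norm_mul, Complex.norm_real, Real.norm_eq_abs]
    gcongr
    exact mul_le_of_le_one_right (abs_nonneg _) hζ
  have hneg : ∀ θ j, (u + (ε * Real.cos θ) • v + ρ θ) j < 0 := fun θ j => by
    have := hdisc (Complex.exp (θ * Complex.I)) (by rw [Complex.norm_exp_ofReal_mul_I]) j
    rw [hnorm] at this
    exact Real.exp_lt_one_iff.1 this
  set Ψ : ℝ → ℝ := fun θ => g₀ + (κ * (ε * Real.cos θ) - δ * (ε * Real.cos θ) ^ 2 +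
    ∑ j, (c j * ρ θ j + M * (ε ^ 4 * v j ^ 4))) with hΨ
  have hΨc : Continuous Ψ := by
    simp only [hΨ]
    fun_prop
  have hle : ∀ θ : ℝ, φ (expPoint u + Complex.exp (θ * Complex.I) • b) ≤ (Ψ θ : EReal) :=
    fun θ => by
    rw [hT.apply_eq_expPoint (hneg θ) (hnorm θ)]
    refine (htouch (ε * Real.cos θ) ?_ (ρ θ) ?_ (hneg θ)).trans (EReal.coe_le_coe_iff.2 ?_)
    · rw [abs_mul, abs_of_pos hε0]
      exact lt_of_le_of_lt (mul_le_of_le_one_right hε0.le (Real.abs_cos_le_one θ)) hεη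
    · exact fun j => (hρb θ j).trans_lt (hv2 j)
    · simp only [hΨ]
      gcongr with j
      have h1 := pow_le_pow_left₀ (abs_nonneg _) (hρb θ j) 2
      rw [sq_abs] at h1
      calc _ ≤ _ := h1
        _ = _ := by ring
  have hsub := (hφ.sub_mean (expPoint u) b hdisc).trans (circleIntegralEReal_mono hle)
  rw [circleIntegralEReal_coe hΨc, hg, ← EReal.coe_mul, EReal.coe_le_coe_iff] at hsub
  have hcos : IntervalIntegrable (fun θ => κ * (ε * Real.cos θ)) volume 0 (2 * Real.pi) :=
    Continuous.intervalIntegrable (by fun_prop) _ _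
  have hcos2 : IntervalIntegrable (fun θ => δ * (ε * Real.cos θ) ^ 2) volume 0 (2 * Real.pi) :=
    Continuous.intervalIntegrable (by fun_prop) _ _
  have hval : ∫ θ in (0 : ℝ)..(2 * Real.pi), Ψ θ = 2 * Real.pi * g₀ +
      (- (δ * ε ^ 2 * Real.pi) + 2 * Real.pi * (M * (ε ^ 4 * ∑ j, v j ^ 4))) := by
    simp only [hΨ]
    rw [intervalIntegral.integral_add (by simp)
      (Continuous.intervalIntegrable (by fun_prop) _ _),
      intervalIntegral.integral_add (hcos.sub hcos2)
      (Continuous.intervalIntegrable (by fun_prop) _ _),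
      intervalIntegral.integral_sub hcos hcos2, intervalIntegral.integral_finsetSum
      (fun j _ => Continuous.intervalIntegrable (by fun_prop) _ _)]
    have h1 : ∀ j, ∫ θ in (0 : ℝ)..(2 * Real.pi), (c j * ρ θ j + M * (ε ^ 4 * v j ^ 4)) =
        2 * Real.pi * (M * (ε ^ 4 * v j ^ 4)) := fun j => by
      rw [intervalIntegral.integral_add (Continuous.intervalIntegrable (by fun_prop) _ _)
        (by simp), intervalIntegral.integral_const_mul, hρint]
      simp
      ring
    simp only [h1, mul_pow, intervalIntegral.integral_const_mul, integral_cos, integral_cos_sq,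
      intervalIntegral.integral_const, ← Finset.mul_sum]
    simp
    ring
  rw [hval] at hsub
  have hpi := Real.pi_pos
  have h3 : 2 * Real.pi * (M * (ε ^ 4 * ∑ j, v j ^ 4)) < δ * ε ^ 2 * Real.pi := by
    have := mul_lt_mul_of_pos_left hMε (show 0 < 2 * Real.pi * ε ^ 2 by positivity)
    calc _ = _ := by ring
      _ < _ := this
      _ = _ := by ring
  linarith

end

/-! ### Convexity in logarithmic coordinates -/

section

variable {n : ℕ} {φ : (Fin n → ℂ) → EReal}

lemma isOpen_negOrthant : IsOpen {u : Fin n → ℝ | ∀ i, u i < 0} := by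
  simp only [Set.ofPred_forall]
  exact isOpen_iInter_of_finite fun i => isOpen_lt (continuous_apply i) continuous_const

lemma IsPlurisubharmonicOn.usc_expPoint (hφ : IsPlurisubharmonicOn φ (polydisc n)) :
    UpperSemicontinuousOn (fun u => φ (expPoint u)) {u : Fin n → ℝ | ∀ i, u i < 0} :=
  hφ.usc.comp continuous_expPoint.continuousOn fun _ hu => expPoint_mem hu

/-- On a nonempty compact set an upper semicontinuous function without the value `⊤` has a real
upper bound. -/
lemma exists_real_bound {X : Type*} [TopologicalSpace X] {f : X → EReal} {K : Set X}
    (hK : IsCompact K) (hf : UpperSemicontinuousOn f K) (htop : ∀ x ∈ K, f x < ⊤) :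
    ∃ C : ℝ, ∀ x ∈ K, f x ≤ C := by
  rcases K.eq_empty_or_nonempty with rfl | hne
  · exact ⟨0, by simp⟩
  obtain ⟨a, ha, hmax⟩ := hf.exists_isMaxOn hne hK
  refine ⟨(f a).toReal, fun x hx => (hmax hx).trans (EReal.le_coe_toReal (htop a ha).ne)⟩

lemma EReal.le_coe_sub_of_add_le {x : EReal} {a b : ℝ} (h : x + (a : EReal) ≤ (b : EReal)) :
    x ≤ ((b - a : ℝ) : EReal) := by
  induction x with
  | bot => exact bot_le
  | top => simp at h
  | coe x =>
    rw [← EReal.coe_add, EReal.coe_le_coe_iff] at h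
    exact EReal.coe_le_coe_iff.2 (by linarith)

/-- A toric plurisubharmonic function is convex in logarithmic coordinates. -/
lemma segment_le (hφ : IsPlurisubharmonicOn φ (polydisc n)) (hT : IsToric φ)
    {p q : Fin n → ℝ} (hp : ∀ i, p i < 0) (hq : ∀ i, q i < 0) {A B : ℝ}
    (hA : φ (expPoint p) < A) (hB : φ (expPoint q) < B) {s : ℝ} (hs0 : 0 < s) (hs1 : s < 1) :
    φ (expPoint (p + s • (q - p))) ≤ ((A + s * (B - A) : ℝ) : EReal) := by
  by_contra hcon
  rw [not_le] at hcon
  have huscA := hφ.usc_expPoint p hp A hA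
  have huscB := hφ.usc_expPoint q hq B hB
  rw [isOpen_negOrthant.nhdsWithin_eq hp] at huscA
  rw [isOpen_negOrthant.nhdsWithin_eq hq] at huscB
  have hA' := huscA.and (isOpen_negOrthant.mem_nhds hp)
  have hB' := huscB.and (isOpen_negOrthant.mem_nhds hq)
  obtain ⟨r₁, hr₁, h₁⟩ := Metric.eventually_nhds_iff_ball.1 hA'
  obtain ⟨r₂, hr₂, h₂⟩ := Metric.eventually_nhds_iff_ball.1 hB'
  obtain ⟨r, hr, hrr⟩ := exists_between (lt_min hr₁ hr₂)
  have hA2 : ∀ w : Fin n → ℝ, ‖w‖ ≤ r → φ (expPoint (p + w)) < A ∧ ∀ i, (p + w) i < 0 :=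
    fun w hw => h₁ _ (by simpa using lt_of_le_of_lt hw (lt_of_lt_of_le hrr (min_le_left _ _)))
  have hB2 : ∀ w : Fin n → ℝ, ‖w‖ ≤ r → φ (expPoint (q + w)) < B ∧ ∀ i, (q + w) i < 0 :=
    fun w hw => h₂ _ (by simpa using lt_of_le_of_lt hw (lt_of_lt_of_le hrr (min_le_right _ _)))
  have hneg : ∀ t : ℝ, 0 ≤ t → t ≤ 1 → ∀ w : Fin n → ℝ, ‖w‖ ≤ r →
      ∀ i, (p + t • (q - p) + w) i < 0 := fun t h0 h1 w hw i => by
    have ha := (hA2 w hw).2 i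
    have hb := (hB2 w hw).2 i
    simp only [Pi.add_apply, Pi.smul_apply, Pi.sub_apply, smul_eq_mul] at ha hb ⊢
    rcases h0.eq_or_lt with rfl | h0
    · linarith
    · nlinarith
  have htop : φ (expPoint (p + s • (q - p))) ≠ ⊤ := by
    have := hφ.lt_top _ (expPoint_mem (hneg s hs0.le hs1.le 0 (by simpa using hr.le)))
    rw [add_zero] at this
    exact this.ne
  obtain ⟨gm, hgm⟩ : ∃ gm : ℝ, φ (expPoint (p + s • (q - p))) = gm :=
    ⟨_, (EReal.coe_toReal htop (ne_bot_of_gt hcon)).symm⟩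
  rw [hgm, EReal.coe_lt_coe_iff] at hcon
  set δ : ℝ := (gm - (A + s * (B - A))) / 2 with hδdef
  have hδ : 0 < δ := by rw [hδdef]; linarith
  -- The chord plus a concave bump that vanishes at both ends. As `δ` is half of the excess of `gm`
  -- over the chord and `s * (1 - s) < 2`, the value `gm` still exceeds `Q s`.
  set Q : ℝ → ℝ := fun t => A + t * (B - A) + δ * (t * (1 - t)) with hQ
  have hQs : Q s < gm := by
    have : δ * (s * (1 - s)) < δ * 2 := by
      apply mul_lt_mul_of_pos_left _ hδ
      nlinarith
    simp only [hQ]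
    rw [hδdef] at this ⊢
    linarith
  set K : Set (ℝ × (Fin n → ℝ)) := Set.Icc 0 1 ×ˢ Metric.closedBall 0 r with hK
  have hKc : IsCompact K := isCompact_Icc.prod (isCompact_closedBall _ _)
  have hKmem : ∀ t w, ((t, w) : ℝ × (Fin n → ℝ)) ∈ K ↔ (0 ≤ t ∧ t ≤ 1) ∧ ‖w‖ ≤ r := fun t w => by
    simp [hK]
  have husc : UpperSemicontinuousOn
      (fun y : ℝ × (Fin n → ℝ) => φ (expPoint (p + y.1 • (q - p) + y.2))) K := by
    refine UpperSemicontinuousOn.comp (g := fun y : ℝ × (Fin n → ℝ) => p + y.1 • (q - p) + y.2)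
      hφ.usc_expPoint (by fun_prop) ?_
    rintro ⟨t, w⟩ hy
    rw [hKmem] at hy
    exact hneg t hy.1.1 hy.1.2 w hy.2
  obtain ⟨C, hC⟩ := exists_real_bound hKc husc (by
    rintro ⟨t, w⟩ hy
    rw [hKmem] at hy
    exact hφ.lt_top _ (expPoint_mem (hneg t hy.1.1 hy.1.2 w hy.2)))
  -- On `‖w‖ = r` the penalty `M * ∑ w i ^ 2` is at least `|C| + |A| + |B|`, hence at least `C - Q
  -- t`. The transversal variable `w` is present because touching must be controlled in all
  -- directions.
  set M : ℝ := (|C| + |A| + |B|) / r ^ 2 with hMdef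
  have hM : 0 ≤ M := by positivity
  set R : ℝ × (Fin n → ℝ) → ℝ := fun y => -(Q y.1) - M * ∑ i, y.2 i ^ 2 with hR
  have hRc : Continuous R := by
    simp only [hR, hQ]
    fun_prop
  have huscH := husc.add' (g := fun y => ((R y : ℝ) : EReal))
    ((continuous_coe_real_ereal.comp hRc).upperSemicontinuous.upperSemicontinuousOn K)
    fun y _ => EReal.continuousAt_add (Or.inr (EReal.coe_ne_bot _)) (Or.inr (EReal.coe_ne_top _))
  have hsK : ((s, 0) : ℝ × (Fin n → ℝ)) ∈ K := (hKmem _ _).2 ⟨⟨hs0.le, hs1.le⟩, by simpa using hr.le⟩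
  -- The maximum is positive by the value at `(s, 0)`. It is therefore not at `t = 0` or `t = 1`,
  -- where `φ` is below `A` or `B`, nor on `‖w‖ = r`: it is an interior maximum.
  obtain ⟨⟨t₀, w₀⟩, hyK, hmax⟩ := huscH.exists_isMaxOn ⟨_, hsK⟩ hKc
  have hmax' : ∀ t w, ((t, w) : ℝ × (Fin n → ℝ)) ∈ K →
      φ (expPoint (p + t • (q - p) + w)) + (R (t, w) : EReal) ≤
      φ (expPoint (p + t₀ • (q - p) + w₀)) + (R (t₀, w₀) : EReal) := fun t w h => hmax h
  obtain ⟨⟨ht0, ht1⟩, hw0⟩ := (hKmem _ _).1 hyK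
  have hneg0 := hneg t₀ ht0 ht1 w₀ hw0
  have h0 := hmax' s 0 hsK
  rw [add_zero, hgm, ← EReal.coe_add] at h0
  have hRs : R (s, 0) = - Q s := by simp [hR]
  obtain ⟨g₀, hg₀⟩ : ∃ g₀ : ℝ, φ (expPoint (p + t₀ • (q - p) + w₀)) = g₀ := by
    refine ⟨_, (EReal.coe_toReal (hφ.lt_top _ (expPoint_mem hneg0)).ne fun hbot => ?_).symm⟩
    rw [hbot, EReal.bot_add] at h0
    exact EReal.coe_ne_bot _ (le_bot_iff.1 h0)
  rw [hg₀, ← EReal.coe_add, EReal.coe_le_coe_iff, hRs] at h0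
  have hpos : Q t₀ + M * ∑ i, w₀ i ^ 2 < g₀ := by
    simp only [hR] at h0
    linarith
  have hsq : 0 ≤ M * ∑ i, w₀ i ^ 2 := mul_nonneg hM (Finset.sum_nonneg fun i _ => sq_nonneg _)
  have ht0' : 0 < t₀ := by
    refine lt_of_le_of_ne ht0 fun h => ?_
    rw [← h, zero_smul, add_zero] at hg₀
    have h1 := (hA2 w₀ hw0).1
    rw [hg₀, EReal.coe_lt_coe_iff] at h1
    simp only [hQ, ← h] at hpos
    linarith
  have ht1' : t₀ < 1 := by
    refine lt_of_le_of_ne ht1 fun h => ?_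
    rw [h, one_smul, add_sub_cancel] at hg₀
    have h1 := (hB2 w₀ hw0).1
    rw [hg₀, EReal.coe_lt_coe_iff] at h1
    simp only [hQ, h] at hpos
    linarith
  have hw0' : ‖w₀‖ < r := by
    rw [pi_norm_lt_iff hr]
    by_contra hcon2
    push Not at hcon2
    obtain ⟨i, hi⟩ := hcon2
    have h1 : r ^ 2 ≤ ∑ i, w₀ i ^ 2 := by
      refine le_trans ?_ (Finset.single_le_sum (fun i _ => sq_nonneg (w₀ i)) (Finset.mem_univ i))
      rw [← sq_abs (w₀ i)]
      exact pow_le_pow_left₀ hr.le hi 2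
    have h2 : |C| + |A| + |B| ≤ M * ∑ i, w₀ i ^ 2 := by
      refine le_trans ?_ (mul_le_mul_of_nonneg_left h1 hM)
      rw [hMdef, div_mul_cancel₀ _ (by positivity)]
    have h3 : -(|A| + |B|) ≤ Q t₀ := by
      have hδt : 0 ≤ δ * (t₀ * (1 - t₀)) :=
        mul_nonneg hδ.le (mul_nonneg ht0 (by linarith))
      have e1 : (1 - t₀) * -|A| ≤ (1 - t₀) * A :=
        mul_le_mul_of_nonneg_left (neg_abs_le A) (by linarith)
      have e2 : t₀ * -|B| ≤ t₀ * B := mul_le_mul_of_nonneg_left (neg_abs_le B) ht0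
      have e3 : t₀ * |A| ≥ 0 := mul_nonneg ht0 (abs_nonneg _)
      have e4 : (1 - t₀) * |B| ≥ 0 := mul_nonneg (by linarith) (abs_nonneg _)
      simp only [hQ]
      linarith
    have h4 := hC _ hyK
    simp only at h4
    rw [hg₀, EReal.coe_le_coe_iff] at h4
    linarith [le_abs_self C]
  -- `κ` is the derivative of `Q` at `t₀` and `c` the gradient of the penalty at `w₀`; both
  -- functions are quadratic, so the expansion is exact.
  refine not_touched_by_concave hφ hT (v := q - p) (c := fun j => 2 * M * w₀ j)
    (κ := B - A + δ * (1 - 2 * t₀)) hneg0 hg₀ hδ hM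
    (lt_min (lt_min ht0' (sub_pos.2 ht1')) (sub_pos.2 hw0')) ?_
  intro t ht ρ hρ _
  rw [lt_min_iff, lt_min_iff, abs_lt] at ht
  have hρn : ‖ρ‖ ≤ r - ‖w₀‖ :=
    (pi_norm_le_iff_of_nonneg (sub_nonneg.2 hw0)).2 fun j =>
      ((hρ j).trans_le (min_le_right _ _)).le
  have hmem : ((t₀ + t, w₀ + ρ) : ℝ × (Fin n → ℝ)) ∈ K := by
    rw [hKmem]
    have := abs_lt.1 ht.1.2
    exact ⟨⟨by linarith, by linarith⟩, (norm_add_le _ _).trans (by linarith)⟩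
  have h1 := hmax' _ _ hmem
  rw [hg₀, ← EReal.coe_add] at h1
  have h2 := EReal.le_coe_sub_of_add_le h1
  have e1 : p + t₀ • (q - p) + w₀ + t • (q - p) + ρ = p + (t₀ + t) • (q - p) + (w₀ + ρ) := by
    rw [add_smul]
    abel
  rw [e1]
  refine h2.trans (EReal.coe_le_coe_iff.2 (le_of_eq ?_))
  have e2 : ∑ i, (w₀ + ρ) i ^ 2 = ∑ i, w₀ i ^ 2 + ∑ i, (2 * w₀ i * ρ i + ρ i ^ 2) := by
    rw [← Finset.sum_add_distrib]
    exact Finset.sum_congr rfl fun i _ => by simp only [Pi.add_apply]; ring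
  have e3 : ∑ j, (2 * M * w₀ j * ρ j + M * ρ j ^ 2) =
      M * ∑ i, (2 * w₀ i * ρ i + ρ i ^ 2) := by
    rw [Finset.mul_sum]
    exact Finset.sum_congr rfl fun i _ => by ring
  simp only [hR, hQ, e2, e3]
  ring

end

/-! ### Monotonicity, the coordinate hyperplanes, and the value `-∞` -/

section

variable {n : ℕ} {φ : (Fin n → ℂ) → EReal}

lemma exists_real_bound_below_expPoint (hφ : IsPlurisubharmonicOn φ (polydisc n))
    {u : Fin n → ℝ} (hu : ∀ i, u i < 0) :
    ∃ C : ℝ, ∀ z : Fin n → ℂ, (∀ i, ‖z i‖ ≤ Real.exp (u i)) → φ z ≤ C := by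
  have hsub : (Set.univ.pi fun i => Metric.closedBall (0 : ℂ) (Real.exp (u i))) ⊆ polydisc n := by
    intro z hz i
    have := hz i (Set.mem_univ i)
    rw [mem_closedBall_zero_iff] at this
    exact this.trans_lt (Real.exp_lt_one_iff.2 (hu i))
  obtain ⟨C, hC⟩ := exists_real_bound
    (isCompact_univ_pi fun i => isCompact_closedBall (0 : ℂ) (Real.exp (u i)))
    (hφ.usc.mono hsub) fun z hz => hφ.lt_top z (hsub hz)
  exact ⟨C, fun z hz => hC z fun i _ => mem_closedBall_zero_iff.2 (hz i)⟩

/-- A toric plurisubharmonic function is nondecreasing in logarithmic coordinates. -/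
lemma expPoint_mono (hφ : IsPlurisubharmonicOn φ (polydisc n)) (hT : IsToric φ)
    {u v : Fin n → ℝ} (hv : ∀ i, v i < 0) (huv : u ≤ v) :
    φ (expPoint u) ≤ φ (expPoint v) := by
  rw [← EReal.le_of_forall_lt_iff_le]
  intro A hA
  have hu : ∀ i, u i < 0 := fun i => (huv i).trans_lt (hv i)
  obtain ⟨C, hC⟩ := exists_real_bound_below_expPoint hφ hu
  have hlim : Tendsto (fun t : ℝ => ((A + (1 + t)⁻¹ * (C + 1 - A) : ℝ) : EReal)) atTop
      (𝓝 ((A : ℝ) : EReal)) := by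
    refine (continuous_coe_real_ereal.tendsto _).comp ?_
    have h1 : Tendsto (fun t : ℝ => (1 + t)⁻¹) atTop (𝓝 0) :=
      tendsto_inv_atTop_zero.comp (tendsto_atTop_add_const_left _ _ tendsto_id)
    simpa using (h1.mul_const (C + 1 - A)).const_add A
  refine ge_of_tendsto hlim ((eventually_gt_atTop 0).mono fun t ht => ?_)
  -- The point `u` lies between `v` and `w`, with weight `(1 + t)⁻¹` on `w`. Since `φ` is bounded
  -- above on the whole ray of points `w`, the contribution of `w` disappears as `t → ∞`.
  set w : Fin n → ℝ := u - t • (v - u) with hw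
  have hwu : ∀ i, w i ≤ u i := fun i => by
    have := mul_nonneg ht.le (sub_nonneg.2 (huv i))
    simp only [hw, Pi.sub_apply, Pi.smul_apply, smul_eq_mul]
    linarith
  have hCw : φ (expPoint w) < ((C + 1 : ℝ) : EReal) := by
    refine (hC _ fun i => ?_).trans_lt (EReal.coe_lt_coe_iff.2 (by linarith))
    rw [norm_expPoint]
    exact Real.exp_le_exp.2 (hwu i)
  have h := segment_le hφ hT hv (fun i => (hwu i).trans_lt (hu i)) hA hCw
    (s := (1 + t)⁻¹) (by positivity) (inv_lt_one_of_one_lt₀ (by linarith))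
  have e : v + (1 + t)⁻¹ • (w - v) = u := by
    ext i
    simp only [hw, Pi.add_apply, Pi.sub_apply, Pi.smul_apply, smul_eq_mul]
    field_simp
    ring
  rwa [e] at h

/-- The disc centred at `z` in the `j`-th coordinate direction has a single torus as boundary, where
`φ` is constant, so the sub-mean inequality becomes a comparison of two values. -/
lemma le_update_of_eq_zero (hφ : IsPlurisubharmonicOn φ (polydisc n)) (hT : IsToric φ)
    {z : Fin n → ℂ} (hz : z ∈ polydisc n) {j : Fin n} (hj : z j = 0) {ρ : ℝ} (hρ0 : 0 ≤ ρ)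
    (hρ : ρ < 1) : φ z ≤ φ (Function.update z j ρ) := by
  have hadd : ∀ ζ : ℂ, z + ζ • (Pi.single j (ρ : ℂ) : Fin n → ℂ) = Function.update z j (ζ * ρ) := by
    intro ζ
    ext i
    rcases eq_or_ne i j with rfl | hij
    · simp [hj]
    · simp [hij]
  have hmem : ∀ ζ : ℂ, ‖ζ‖ ≤ 1 → Function.update z j (ζ * ρ) ∈ polydisc n := by
    intro ζ hζ i
    rcases eq_or_ne i j with rfl | hij
    · simp only [Function.update_self, norm_mul, Complex.norm_real, Real.norm_of_nonneg hρ0]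
      nlinarith
    · simpa [hij] using hz i
  have hmem1 : Function.update z j (ρ : ℂ) ∈ polydisc n := by
    simpa using hmem 1 (by simp)
  have hconst : ∀ θ : ℝ, φ (z + Complex.exp (θ * Complex.I) • (Pi.single j (ρ : ℂ) : Fin n → ℂ)) =
      φ (Function.update z j ρ) := fun θ => by
    rw [hadd]
    refine hT _ (hmem _ (by rw [Complex.norm_exp_ofReal_mul_I])) _ hmem1 fun i => ?_
    rcases eq_or_ne i j with rfl | hij
    · simp [Complex.norm_exp_ofReal_mul_I]
    · simp [hij]
  have h := hφ.sub_mean z (Pi.single j (ρ : ℂ)) fun ζ hζ => by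
    rw [hadd]
    exact hmem ζ hζ
  simp only [hconst] at h
  have htop := (hφ.lt_top _ hmem1).ne
  have hpi : (0 : ℝ) < 2 * Real.pi := by positivity
  generalize φ (Function.update z j ρ) = c at h htop
  induction c with
  | top => exact absurd rfl htop
  | bot =>
    rw [circleIntegralEReal_bot, le_bot_iff] at h
    have htop' := (hφ.lt_top _ hz).ne
    generalize φ z = d at h htop'
    induction d with
    | top => exact absurd rfl htop'
    | bot => exact le_rfl
    | coe d =>
      rw [← EReal.coe_mul] at h
      exact absurd h (EReal.coe_ne_bot _)
  | coe c =>
    rw [circleIntegralEReal_coe continuous_const, intervalIntegral.integral_const] at h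
    have htop' := (hφ.lt_top _ hz).ne
    generalize φ z = d at h htop'
    induction d with
    | top => exact absurd rfl htop'
    | bot => exact bot_le
    | coe d =>
      rw [← EReal.coe_mul, EReal.coe_le_coe_iff, sub_zero, smul_eq_mul] at h
      exact EReal.coe_le_coe_iff.2 (le_of_mul_le_mul_left h hpi)

/-- Logarithmic coordinates miss the points with a vanishing coordinate. Such coordinates are first
raised, one at a time, to the radius `exp (u i)`; monotonicity then applies. -/
lemma le_expPoint (hφ : IsPlurisubharmonicOn φ (polydisc n)) (hT : IsToric φ)
    {u : Fin n → ℝ} (hu : ∀ i, u i < 0) {z : Fin n → ℂ} (hz : ∀ i, ‖z i‖ ≤ Real.exp (u i)) :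
    φ z ≤ φ (expPoint u) := by
  set w : Fin n → ℂ := fun i => if z i = 0 then (Real.exp (u i) : ℂ) else z i with hw
  have hwn : ∀ i, w i ≠ 0 := fun i => by
    simp only [hw]
    split_ifs with h
    · exact_mod_cast (Real.exp_pos _).ne'
    · exact h
  have hwle : ∀ i, ‖w i‖ ≤ Real.exp (u i) := fun i => by
    simp only [hw]
    split_ifs with h
    · rw [Complex.norm_real, Real.norm_of_nonneg (Real.exp_pos _).le]
    · exact hz i
  have hstep : ∀ s : Finset (Fin n), φ z ≤ φ fun i => if i ∈ s then w i else z i := by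
    intro s
    induction s using Finset.induction_on with
    | empty => simp
    | insert j s hj ih =>
      refine ih.trans ?_
      by_cases hzj : z j = 0
      · have := le_update_of_eq_zero hφ hT (z := fun i => if i ∈ s then w i else z i) (j := j)
          (fun i => ?_) (by simp [hj, hzj]) (Real.exp_pos (u j)).le (Real.exp_lt_one_iff.2 (hu j))
        · refine this.trans (le_of_eq (congrArg φ ?_))
          ext i
          rcases eq_or_ne i j with rfl | hij
          · simp [hw, hzj]
          · simp [hij]
        · refine lt_of_le_of_lt ?_ (Real.exp_lt_one_iff.2 (hu i))
          dsimp only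
          split_ifs
          exacts [hwle i, hz i]
      · refine le_of_eq (congrArg φ ?_)
        ext i
        rcases eq_or_ne i j with rfl | hij
        · simp [hw, hzj]
        · simp [hij]
  have h1 := hstep Finset.univ
  simp only [Finset.mem_univ, if_true] at h1
  have hlog : ∀ i, Real.log ‖w i‖ ≤ u i := fun i =>
    (Real.log_le_iff_le_exp (norm_pos_iff.2 (hwn i))).2 (hwle i)
  rw [hT.apply_eq_expPoint (u := fun i => Real.log ‖w i‖) (fun i => (hlog i).trans_lt (hu i))
    (fun i => (Real.exp_log (norm_pos_iff.2 (hwn i))).symm)] at h1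
  exact h1.trans (expPoint_mono hφ hT hu hlog)

/-- In logarithmic coordinates, a toric plurisubharmonic function that takes the value `-∞` is
identically `-∞`. -/
lemma expPoint_eq_bot (hφ : IsPlurisubharmonicOn φ (polydisc n)) (hT : IsToric φ)
    {p q : Fin n → ℝ} (hp : ∀ i, p i < 0) (hq : ∀ i, q i < 0) (hbot : φ (expPoint p) = ⊥) :
    φ (expPoint q) = ⊥ := by
  have hev : ∀ᶠ ε : ℝ in 𝓝[>] 0, 0 < ε ∧ ∀ i, (q + ε • (q - p)) i < 0 := by
    refine eventually_mem_nhdsWithin.and (Filter.Eventually.filter_mono nhdsWithin_le_nhds ?_)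
    have : ContinuousAt (fun ε : ℝ => q + ε • (q - p)) 0 := by fun_prop
    exact this.eventually (isOpen_negOrthant.mem_nhds (by simpa using hq))
  obtain ⟨ε, hε, hneg⟩ := hev.exists
  rw [EReal.eq_bot_iff_forall_lt]
  intro y
  obtain ⟨B, hB, -⟩ := EReal.lt_iff_exists_real_btwn.1 (hφ.lt_top _ (expPoint_mem hneg))
  set s : ℝ := (1 + ε)⁻¹ with hs
  have hs1 : s < 1 := inv_lt_one_of_one_lt₀ (by linarith)
  -- Any real `A` is an admissible bound at `p`, where `φ = -∞`. This choice makes the interpolated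
  -- bound at `q` equal to `y - 1`.
  set A : ℝ := (y - 1 - s * B) / (1 - s) with hA
  have h := segment_le hφ hT hp hneg (A := A) (by rw [hbot]; exact EReal.bot_lt_coe _) hB
    (s := s) (by positivity) hs1
  have e : p + s • (q + ε • (q - p) - p) = q := by
    ext i
    simp only [hs, Pi.add_apply, Pi.sub_apply, Pi.smul_apply, smul_eq_mul]
    field_simp
    ring
  rw [e] at h
  refine h.trans_lt (EReal.coe_lt_coe_iff.2 ?_)
  have : (1 - s) * A = y - 1 - s * B := mul_div_cancel₀ _ (by linarith)
  linarith

lemma kiselmanQuotient_eq (hT : IsToric φ) {x : Fin n → ℝ} (hx : ∀ i, 0 < x i) {s : ℝ}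
    (hs : s < 0) : kiselmanQuotient φ x s = φ (expPoint (s • x)) / (s : EReal) := by
  have hneg : ∀ i, (s • x) i < 0 := fun i => mul_neg_of_neg_of_pos hs (hx i)
  have : φ '' {z | ∀ i, ‖z i‖ = Real.exp (s * x i)} = {φ (expPoint (s • x))} := by
    refine Set.eq_singleton_iff_unique_mem.2 ⟨⟨expPoint (s • x), fun i => norm_expPoint _ _, rfl⟩, ?_⟩
    rintro _ ⟨z, hz, rfl⟩
    exact hT.apply_eq_expPoint hneg hz
  rw [kiselmanQuotient, this, sSup_singleton]

end

/-! ### Slopes along rays: existence and properties of Kiselman's limit -/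

section

variable {n : ℕ} {φ : (Fin n → ℂ) → EReal}

/-- A convex function on `(0, ∞)` that is nonincreasing has a finite slope at infinity. -/
lemma exists_tendsto_neg_div {h : ℝ → ℝ} (hc : ConvexOn ℝ (Set.Ioi 0) h)
    (ha : AntitoneOn h (Set.Ioi 0)) :
    ∃ L : ℝ, 0 ≤ L ∧ Tendsto (fun r => -h r / r) atTop (𝓝 L) := by
  -- Minus the secant slope from `1`, which is monotone by convexity. Truncating at `2` keeps the
  -- denominator positive and makes `q` antitone on the whole line.
  set q : ℝ → ℝ := fun r => -((h (max r 2) - h 1) / (max r 2 - 1)) with hq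
  have hmax : ∀ r : ℝ, 2 ≤ max r 2 := fun r => le_max_right _ _
  have hq0 : ∀ r, 0 ≤ q r := fun r => by
    have h2 := hmax r
    have h1 : h (max r 2) ≤ h 1 :=
      ha (Set.mem_Ioi.2 one_pos) (Set.mem_Ioi.2 (by linarith)) (by linarith)
    simp only [hq]
    rw [neg_nonneg]
    exact div_nonpos_of_nonpos_of_nonneg (by linarith) (by linarith)
  have hanti : Antitone q := fun r r' hrr => by
    have h2 := hmax r
    have h2' := hmax r'
    exact neg_le_neg (hc.secant_mono (Set.mem_Ioi.2 one_pos) (Set.mem_Ioi.2 (by linarith))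
      (Set.mem_Ioi.2 (by linarith)) (by linarith) (by linarith) (max_le_max_right _ hrr))
  have hlim : Tendsto q atTop (𝓝 (⨅ r, q r)) :=
    tendsto_atTop_ciInf hanti ⟨0, by rintro _ ⟨r, rfl⟩; exact hq0 r⟩
  refine ⟨_, Real.iInf_nonneg hq0, ?_⟩
  have hinv : Tendsto (fun r : ℝ => r⁻¹) atTop (𝓝 0) := tendsto_inv_atTop_zero
  have h3 : Tendsto (fun r => q r * (1 - r⁻¹) - h 1 * r⁻¹) atTop (𝓝 ((⨅ r, q r) * (1 - 0) - h 1 * 0)) :=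
    (hlim.mul (hinv.const_sub 1)).sub (hinv.const_mul _)
  simp only [sub_zero, mul_one, mul_zero] at h3
  refine h3.congr' ((eventually_ge_atTop 2).mono fun r hr => ?_)
  have hr1 : r - 1 ≠ 0 := by linarith
  have hr0 : r ≠ 0 := by linarith
  simp only [hq, max_eq_left hr]
  field_simp
  ring

/-- The values of `φ` in logarithmic coordinates, as real numbers. -/
noncomputable def logProfile (φ : (Fin n → ℂ) → EReal) (u : Fin n → ℝ) : ℝ :=
  (φ (expPoint u)).toReal

lemma coe_logProfile (hφ : IsPlurisubharmonicOn φ (polydisc n))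
    (hfin : ∀ u : Fin n → ℝ, (∀ i, u i < 0) → φ (expPoint u) ≠ ⊥) {u : Fin n → ℝ}
    (hu : ∀ i, u i < 0) : (logProfile φ u : EReal) = φ (expPoint u) :=
  EReal.coe_toReal (hφ.lt_top _ (expPoint_mem hu)).ne (hfin u hu)

lemma logProfile_mono (hφ : IsPlurisubharmonicOn φ (polydisc n)) (hT : IsToric φ)
    (hfin : ∀ u : Fin n → ℝ, (∀ i, u i < 0) → φ (expPoint u) ≠ ⊥) {u v : Fin n → ℝ}
    (hv : ∀ i, v i < 0) (huv : u ≤ v) : logProfile φ u ≤ logProfile φ v := by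
  rw [← EReal.coe_le_coe_iff, coe_logProfile hφ hfin fun i => (huv i).trans_lt (hv i),
    coe_logProfile hφ hfin hv]
  exact expPoint_mono hφ hT hv huv

lemma convexOn_logProfile (hφ : IsPlurisubharmonicOn φ (polydisc n)) (hT : IsToric φ)
    (hfin : ∀ u : Fin n → ℝ, (∀ i, u i < 0) → φ (expPoint u) ≠ ⊥) :
    ConvexOn ℝ {u : Fin n → ℝ | ∀ i, u i < 0} (logProfile φ) := by
  have hconv : Convex ℝ {u : Fin n → ℝ | ∀ i, u i < 0} := by
    intro u hu v hv a b ha hb hab i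
    have h1 := hu i
    have h2 := hv i
    simp only [Pi.add_apply, Pi.smul_apply, smul_eq_mul]
    rcases ha.eq_or_lt with rfl | ha
    · rw [zero_add] at hab
      simpa [hab] using h2
    · nlinarith
  refine convexOn_iff_forall_pos.2 ⟨hconv, fun u hu v hv a b ha hb hab => ?_⟩
  refine le_of_forall_pos_le_add fun ε hε => ?_
  have h := segment_le hφ hT hu hv (A := logProfile φ u + ε) (B := logProfile φ v + ε) (s := b)
    (by rw [← coe_logProfile hφ hfin hu, EReal.coe_lt_coe_iff]; linarith)
    (by rw [← coe_logProfile hφ hfin hv, EReal.coe_lt_coe_iff]; linarith) hb (by linarith)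
  have e : u + b • (v - u) = a • u + b • v := by
    rw [← eq_sub_iff_add_eq] at hab
    subst hab
    module
  rw [e, ← coe_logProfile hφ hfin (hconv hu hv ha.le hb.le hab), EReal.coe_le_coe_iff] at h
  refine h.trans (le_of_eq ?_)
  simp only [smul_eq_mul]
  rw [← eq_sub_iff_add_eq] at hab
  subst hab
  ring

lemma smul_neg_of_neg {x : Fin n → ℝ} (hx : ∀ i, 0 < x i) {s : ℝ} (hs : s < 0) :
    ∀ i, (s • x) i < 0 := fun i => mul_neg_of_neg_of_pos hs (hx i)

lemma neg_smul_neg_of_pos {x : Fin n → ℝ} (hx : ∀ i, 0 < x i) {r : ℝ} (hr : 0 < r) :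
    ∀ i, ((-r) • x) i < 0 := fun i => mul_neg_of_neg_of_pos (neg_neg_of_pos hr) (hx i)

lemma exists_tendsto_logProfile (hφ : IsPlurisubharmonicOn φ (polydisc n)) (hT : IsToric φ)
    (hfin : ∀ u : Fin n → ℝ, (∀ i, u i < 0) → φ (expPoint u) ≠ ⊥) {x : Fin n → ℝ}
    (hx : ∀ i, 0 < x i) :
    ∃ L : ℝ, 0 ≤ L ∧ Tendsto (fun r : ℝ => -logProfile φ ((-r) • x) / r) atTop (𝓝 L) := by
  have h := ((convexOn_logProfile hφ hT hfin).comp_linearMap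
    (LinearMap.toSpanSingleton ℝ (Fin n → ℝ) (-x))).subset (s := Set.Ioi (0 : ℝ))
    (fun r hr i => by simpa using mul_pos (Set.mem_Ioi.1 hr) (hx i)) (convex_Ioi 0)
  refine exists_tendsto_neg_div (h := fun r => logProfile φ ((-r) • x)) ?_ ?_
  · refine h.congr fun r _ => ?_
    simp
  · intro r hr r' hr' hrr
    refine logProfile_mono hφ hT hfin (neg_smul_neg_of_pos hx hr) fun i => ?_
    simp only [Pi.smul_apply, smul_eq_mul]
    exact mul_le_mul_of_nonneg_right (neg_le_neg hrr) (hx i).le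

/-- Either `φ` is `-∞` off the coordinate hyperplanes, or it is finite there. -/
lemma bot_or_finite (hφ : IsPlurisubharmonicOn φ (polydisc n)) (hT : IsToric φ) :
    (∀ u : Fin n → ℝ, (∀ i, u i < 0) → φ (expPoint u) = ⊥) ∨
      ∀ u : Fin n → ℝ, (∀ i, u i < 0) → φ (expPoint u) ≠ ⊥ := by
  by_cases h : ∃ u : Fin n → ℝ, (∀ i, u i < 0) ∧ φ (expPoint u) = ⊥
  · obtain ⟨p, hp, hbot⟩ := h
    exact Or.inl fun u hu => expPoint_eq_bot hφ hT hp hu hbot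
  · push Not at h
    exact Or.inr h

lemma tendsto_kiselmanQuotient_of_bot (hT : IsToric φ)
    (hbot : ∀ u : Fin n → ℝ, (∀ i, u i < 0) → φ (expPoint u) = ⊥) {x : Fin n → ℝ}
    (hx : ∀ i, 0 < x i) : Tendsto (kiselmanQuotient φ x) atBot (𝓝 ⊤) := by
  refine tendsto_const_nhds.congr' ((eventually_lt_atBot 0).mono fun s hs => ?_)
  rw [kiselmanQuotient_eq hT hx hs, hbot _ (smul_neg_of_neg hx hs),
    EReal.bot_div_of_neg_ne_bot (EReal.coe_neg'.2 hs) (EReal.coe_ne_bot _)]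

lemma tendsto_kiselmanQuotient_of_finite (hφ : IsPlurisubharmonicOn φ (polydisc n)) (hT : IsToric φ)
    (hfin : ∀ u : Fin n → ℝ, (∀ i, u i < 0) → φ (expPoint u) ≠ ⊥) {x : Fin n → ℝ}
    (hx : ∀ i, 0 < x i) {L : ℝ}
    (hL : Tendsto (fun r : ℝ => -logProfile φ ((-r) • x) / r) atTop (𝓝 L)) :
    Tendsto (kiselmanQuotient φ x) atBot (𝓝 (L : EReal)) := by
  have h := ((continuous_coe_real_ereal.tendsto _).comp hL).comp tendsto_neg_atBot_atTop
  refine h.congr' ((eventually_lt_atBot 0).mono fun s hs => ?_)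
  rw [kiselmanQuotient_eq hT hx hs, ← coe_logProfile hφ hfin (smul_neg_of_neg hx hs)]
  simp only [Function.comp_apply, neg_neg]
  rw [← EReal.coe_div, neg_div_neg_eq]

lemma kiselmanInterior_of_bot (hT : IsToric φ)
    (hbot : ∀ u : Fin n → ℝ, (∀ i, u i < 0) → φ (expPoint u) = ⊥) {x : Fin n → ℝ}
    (hx : ∀ i, 0 < x i) : kiselmanInterior φ x = ⊤ := by
  rw [kiselmanInterior, (tendsto_kiselmanQuotient_of_bot hT hbot hx).limsup_eq, EReal.toENNReal_top]

lemma kiselmanInterior_of_tendsto (hφ : IsPlurisubharmonicOn φ (polydisc n)) (hT : IsToric φ)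
    (hfin : ∀ u : Fin n → ℝ, (∀ i, u i < 0) → φ (expPoint u) ≠ ⊥) {x : Fin n → ℝ}
    (hx : ∀ i, 0 < x i) {L : ℝ}
    (hL : Tendsto (fun r : ℝ => -logProfile φ ((-r) • x) / r) atTop (𝓝 L)) :
    kiselmanInterior φ x = ENNReal.ofReal L := by
  rw [kiselmanInterior, (tendsto_kiselmanQuotient_of_finite hφ hT hfin hx hL).limsup_eq,
    EReal.toENNReal_of_ne_top (EReal.coe_ne_top _), EReal.toReal_coe]

lemma tendsto_kiselmanQuotient (hφ : IsPlurisubharmonicOn φ (polydisc n)) (hT : IsToric φ)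
    {x : Fin n → ℝ} (hx : ∀ i, 0 < x i) :
    Tendsto (kiselmanQuotient φ x) atBot (𝓝 (kiselmanInterior φ x : EReal)) := by
  rcases bot_or_finite hφ hT with hbot | hfin
  · rw [kiselmanInterior_of_bot hT hbot hx]
    exact tendsto_kiselmanQuotient_of_bot hT hbot hx
  · obtain ⟨L, hL0, hL⟩ := exists_tendsto_logProfile hφ hT hfin hx
    rw [kiselmanInterior_of_tendsto hφ hT hfin hx hL, EReal.coe_ennreal_ofReal, max_eq_left hL0]
    exact tendsto_kiselmanQuotient_of_finite hφ hT hfin hx hL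

lemma kiselmanInterior_mono (hφ : IsPlurisubharmonicOn φ (polydisc n)) (hT : IsToric φ)
    {x y : Fin n → ℝ} (hx : ∀ i, 0 < x i) (hxy : x ≤ y) :
    kiselmanInterior φ x ≤ kiselmanInterior φ y := by
  have hy : ∀ i, 0 < y i := fun i => (hx i).trans_le (hxy i)
  rcases bot_or_finite hφ hT with hbot | hfin
  · rw [kiselmanInterior_of_bot hT hbot hx, kiselmanInterior_of_bot hT hbot hy]
  · obtain ⟨L, -, hL⟩ := exists_tendsto_logProfile hφ hT hfin hx
    obtain ⟨L', -, hL'⟩ := exists_tendsto_logProfile hφ hT hfin hy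
    rw [kiselmanInterior_of_tendsto hφ hT hfin hx hL, kiselmanInterior_of_tendsto hφ hT hfin hy hL']
    refine ENNReal.ofReal_le_ofReal (le_of_tendsto_of_tendsto hL hL'
      ((eventually_gt_atTop 0).mono fun r hr => ?_))
    refine div_le_div_of_nonneg_right (neg_le_neg (logProfile_mono hφ hT hfin
      (neg_smul_neg_of_pos hx hr) fun i => ?_)) hr.le
    exact mul_le_mul_of_nonpos_left (hxy i) (neg_nonpos.2 hr.le)

lemma kiselmanInterior_smul (hφ : IsPlurisubharmonicOn φ (polydisc n)) (hT : IsToric φ)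
    {x : Fin n → ℝ} (hx : ∀ i, 0 < x i) {c : ℝ} (hc : 0 < c) :
    kiselmanInterior φ (c • x) = ENNReal.ofReal c * kiselmanInterior φ x := by
  have hcx : ∀ i, 0 < (c • x) i := fun i => mul_pos hc (hx i)
  rcases bot_or_finite hφ hT with hbot | hfin
  · rw [kiselmanInterior_of_bot hT hbot hx, kiselmanInterior_of_bot hT hbot hcx,
      ENNReal.mul_top (by simpa using hc)]
  · obtain ⟨L, -, hL⟩ := exists_tendsto_logProfile hφ hT hfin hx
    have h : Tendsto (fun r : ℝ => -logProfile φ ((-r) • (c • x)) / r) atTop (𝓝 (c * L)) := by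
      refine ((hL.comp (tendsto_id.atTop_mul_const hc)).const_mul c).congr'
        ((eventually_gt_atTop 0).mono fun r hr => ?_)
      simp only [Function.comp_apply, id]
      rw [smul_smul, neg_mul]
      field_simp
    rw [kiselmanInterior_of_tendsto hφ hT hfin hx hL, kiselmanInterior_of_tendsto hφ hT hfin hcx h,
      ENNReal.ofReal_mul hc.le]

/-- Midpoint convexity between `-2r x` and `-2r y`, whose midpoint is `-r (x + y)`. Together with
homogeneity this says that the refined Lelong number is concave. -/
lemma kiselmanInterior_add (hφ : IsPlurisubharmonicOn φ (polydisc n)) (hT : IsToric φ)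
    {x y : Fin n → ℝ} (hx : ∀ i, 0 < x i) (hy : ∀ i, 0 < y i) :
    kiselmanInterior φ x + kiselmanInterior φ y ≤ kiselmanInterior φ (x + y) := by
  have hxy : ∀ i, 0 < (x + y) i := fun i => add_pos (hx i) (hy i)
  rcases bot_or_finite hφ hT with hbot | hfin
  · rw [kiselmanInterior_of_bot hT hbot hxy]
    exact le_top
  · obtain ⟨L, hL0, hL⟩ := exists_tendsto_logProfile hφ hT hfin hx
    obtain ⟨L', hL0', hL'⟩ := exists_tendsto_logProfile hφ hT hfin hy
    obtain ⟨L'', -, hL''⟩ := exists_tendsto_logProfile hφ hT hfin hxy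
    rw [kiselmanInterior_of_tendsto hφ hT hfin hx hL, kiselmanInterior_of_tendsto hφ hT hfin hy hL',
      kiselmanInterior_of_tendsto hφ hT hfin hxy hL'', ← ENNReal.ofReal_add hL0 hL0']
    have h2 : Tendsto (fun r : ℝ => 2 * r) atTop atTop := tendsto_id.const_mul_atTop two_pos
    refine ENNReal.ofReal_le_ofReal (le_of_tendsto_of_tendsto ((hL.comp h2).add (hL'.comp h2)) hL''
      ((eventually_gt_atTop 0).mono fun r hr => ?_))
    have hconv := (convexOn_logProfile hφ hT hfin).2
      (neg_smul_neg_of_pos hx (show 0 < 2 * r by linarith))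
      (neg_smul_neg_of_pos hy (show 0 < 2 * r by linarith))
      (show (0 : ℝ) ≤ 1 / 2 by norm_num) (show (0 : ℝ) ≤ 1 / 2 by norm_num) (by norm_num)
    have e : (1 / 2 : ℝ) • (-(2 * r)) • x + (1 / 2 : ℝ) • (-(2 * r)) • y = (-r) • (x + y) := by
      module
    rw [e] at hconv
    simp only [smul_eq_mul] at hconv
    simp only [Function.comp_apply]
    rw [← add_div, div_le_div_iff₀ (by positivity) hr]
    nlinarith

end

/-! ### Continuous extension to the closed orthant -/

section

variable {n : ℕ} {φ : (Fin n → ℂ) → EReal}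

/-- The extension of a monotone function from the open orthant to the closed one. -/
noncomputable def orthantExt (K : (Fin n → ℝ) → ℝ≥0∞) (x : Fin n → ℝ) : ℝ≥0∞ :=
  ⨅ ε : Set.Ioi (0 : ℝ), K fun i => x i + ε

section orthantExt

variable {K : (Fin n → ℝ) → ℝ≥0∞}

lemma orthantExt_le {x : Fin n → ℝ} {ε : ℝ} (hε : 0 < ε) :
    orthantExt K x ≤ K fun i => x i + ε :=
  iInf_le (fun ε : Set.Ioi (0 : ℝ) => K fun i => x i + ε) ⟨ε, hε⟩

lemma orthantExt_mono
    (hmono : ∀ x y : Fin n → ℝ, (∀ i, 0 < x i) → x ≤ y → K x ≤ K y)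
    {x y : Fin n → ℝ} (hx : ∀ i, 0 ≤ x i) (hxy : x ≤ y) :
    orthantExt K x ≤ orthantExt K y :=
  le_iInf fun ε => (orthantExt_le ε.2).trans
    (hmono _ _ (fun i => add_pos_of_nonneg_of_pos (hx i) ε.2) fun i => add_le_add_left (hxy i) _)

lemma orthantExt_smul
    (hsmul : ∀ (x : Fin n → ℝ) (c : ℝ), (∀ i, 0 < x i) → 0 < c →
      K (c • x) = ENNReal.ofReal c * K x)
    {x : Fin n → ℝ} (hx : ∀ i, 0 ≤ x i) {c : ℝ} (hc : 0 < c) :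
    orthantExt K (c • x) = ENNReal.ofReal c * orthantExt K x := by
  have key : ∀ ε : ℝ, 0 < ε → K (fun i => (c • x) i + ε) =
      ENNReal.ofReal c * K (fun i => x i + ε / c) := fun ε hε => by
    rw [← hsmul _ c (fun i => add_pos_of_nonneg_of_pos (hx i) (div_pos hε hc)) hc]
    congr 1
    ext i
    simp only [Pi.smul_apply, smul_eq_mul]
    field_simp
  have hc' : ENNReal.ofReal c ≠ 0 := by simpa using hc
  rw [orthantExt, orthantExt, ENNReal.mul_iInf_of_ne hc' ENNReal.ofReal_ne_top]
  refine le_antisymm (le_iInf fun ε => ?_) (le_iInf fun ε => ?_)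
  · refine (iInf_le _ ⟨c * ε, mul_pos hc ε.2⟩).trans (le_of_eq ?_)
    rw [key _ (mul_pos hc ε.2), mul_div_cancel_left₀ _ hc.ne']
  · rw [key _ ε.2]
    exact iInf_le (fun ε : Set.Ioi (0 : ℝ) => ENNReal.ofReal c * K fun i => x i + ε)
      ⟨ε / c, div_pos ε.2 hc⟩

lemma orthantExt_add
    (hadd : ∀ x y : Fin n → ℝ, (∀ i, 0 < x i) → (∀ i, 0 < y i) → K x + K y ≤ K (x + y))
    {x y : Fin n → ℝ} (hx : ∀ i, 0 ≤ x i) (hy : ∀ i, 0 ≤ y i) :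
    orthantExt K x + orthantExt K y ≤ orthantExt K (x + y) := by
  refine le_iInf fun ε => ?_
  have hε : (0 : ℝ) < ε / 2 := half_pos ε.2
  refine (add_le_add (orthantExt_le hε) (orthantExt_le hε)).trans ((hadd _ _
    (fun i => add_pos_of_nonneg_of_pos (hx i) hε)
    (fun i => add_pos_of_nonneg_of_pos (hy i) hε)).trans (le_of_eq ?_))
  congr 1
  ext i
  simp only [Pi.add_apply]
  ring

/-- Lower semicontinuity comes from homogeneity: for `c < 1` every nearby `y` in the orthant
satisfies `c • x ≤ y`, including where `x i = 0`. Upper semicontinuity comes from the infimum: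
nearby `y` lie below `x + ε / 2`. -/
lemma orthantExt_continuousWithinAt
    (hmono : ∀ x y : Fin n → ℝ, (∀ i, 0 < x i) → x ≤ y → K x ≤ K y)
    (hsmul : ∀ (x : Fin n → ℝ) (c : ℝ), (∀ i, 0 < x i) → 0 < c →
      K (c • x) = ENNReal.ofReal c * K x)
    {x : Fin n → ℝ} (hx : ∀ i, 0 ≤ x i) :
    ContinuousWithinAt (orthantExt K) {x : Fin n → ℝ | ∀ i, 0 ≤ x i} x := by
  refine tendsto_order.2 ⟨fun b hb => ?_, fun b hb => ?_⟩
  · have hlim : Tendsto (fun c : ℝ => ENNReal.ofReal c * orthantExt K x) (𝓝[<] 1)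
        (𝓝 (orthantExt K x)) := by
      have h1 : Tendsto (fun c : ℝ => ENNReal.ofReal c) (𝓝[<] 1) (𝓝 1) := by
        rw [← ENNReal.ofReal_one]
        exact (ENNReal.continuous_ofReal.tendsto 1).mono_left nhdsWithin_le_nhds
      simpa using ENNReal.Tendsto.mul_const (b := orthantExt K x) h1 (Or.inl one_ne_zero)
    have hev := (hlim.eventually (lt_mem_nhds hb)).and
      ((eventually_mem_nhdsWithin (s := Set.Iio (1 : ℝ))).and
        (nhdsWithin_le_nhds (lt_mem_nhds one_pos)))
    obtain ⟨c, hbc, hc1, hc0⟩ := hev.exists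
    have hnear : ∀ᶠ y in 𝓝[{x : Fin n → ℝ | ∀ i, 0 ≤ x i}] x, ∀ i, c * x i ≤ y i := by
      refine eventually_all.2 fun i => ?_
      rcases (hx i).eq_or_lt with h0 | h0
      · filter_upwards [self_mem_nhdsWithin] with y hy
        rw [← h0, mul_zero]
        exact hy i
      · have h2 : c * x i < x i := mul_lt_of_lt_one_left h0 hc1
        have : ContinuousAt (fun y : Fin n → ℝ => y i) x := continuousAt_apply i x
        exact nhdsWithin_le_nhds ((this.eventually (lt_mem_nhds h2)).mono fun _ h => le_of_lt h)
    filter_upwards [hnear] with y hy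
    refine hbc.trans_le ?_
    rw [← orthantExt_smul hsmul hx hc0]
    exact orthantExt_mono hmono (fun i => mul_nonneg hc0.le (hx i)) hy
  · obtain ⟨ε, hε⟩ := iInf_lt_iff.1 hb
    have hε0 : (0 : ℝ) < ε / 2 := half_pos ε.2
    have hnear : ∀ᶠ y in 𝓝 x, ∀ i, y i < x i + ε / 2 := by
      refine eventually_all.2 fun i => ?_
      have : ContinuousAt (fun y : Fin n → ℝ => y i) x := continuousAt_apply i x
      exact this.eventually (gt_mem_nhds (by linarith))
    filter_upwards [self_mem_nhdsWithin, nhdsWithin_le_nhds hnear] with y hy0 hy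
    refine ((orthantExt_le hε0).trans (hmono _ _
      (fun i => add_pos_of_nonneg_of_pos (hy0 i) hε0) fun i => ?_)).trans_lt hε
    have := hy i
    dsimp only
    linarith

/-- At an interior point `x + ε ≤ c • x` for every `c > 1` and small `ε`, so homogeneity rules out a
jump. -/
lemma orthantExt_eq
    (hmono : ∀ x y : Fin n → ℝ, (∀ i, 0 < x i) → x ≤ y → K x ≤ K y)
    (hsmul : ∀ (x : Fin n → ℝ) (c : ℝ), (∀ i, 0 < x i) → 0 < c →
      K (c • x) = ENNReal.ofReal c * K x)
    {x : Fin n → ℝ} (hx : ∀ i, 0 < x i) : orthantExt K x = K x := by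
  refine le_antisymm ?_ (le_iInf fun ε => hmono _ _ hx fun i => le_add_of_nonneg_right ε.2.le)
  have hlim : Tendsto (fun c : ℝ => ENNReal.ofReal c * K x) (𝓝[>] 1) (𝓝 (K x)) := by
    have h1 : Tendsto (fun c : ℝ => ENNReal.ofReal c) (𝓝[>] 1) (𝓝 1) := by
      rw [← ENNReal.ofReal_one]
      exact (ENNReal.continuous_ofReal.tendsto 1).mono_left nhdsWithin_le_nhds
    simpa using ENNReal.Tendsto.mul_const (b := K x) h1 (Or.inl one_ne_zero)
  refine ge_of_tendsto hlim (eventually_mem_nhdsWithin.mono fun c hc => ?_)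
  have hc1 : 1 < c := hc
  have hev : ∀ᶠ ε : ℝ in 𝓝[>] 0, 0 < ε ∧ ∀ i, x i + ε < c * x i := by
    refine eventually_mem_nhdsWithin.and (Filter.Eventually.filter_mono nhdsWithin_le_nhds ?_)
    refine eventually_all.2 fun i => ?_
    have : ContinuousAt (fun ε : ℝ => x i + ε) 0 := by fun_prop
    exact this.eventually (gt_mem_nhds (by simpa using lt_mul_of_one_lt_left (hx i) hc1))
  obtain ⟨ε, hε, hle⟩ := hev.exists
  rw [← hsmul _ _ hx (by linarith)]
  exact (orthantExt_le hε).trans (hmono _ _ (fun i => add_pos (hx i) hε) fun i => (hle i).le)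

end orthantExt

lemma refinedLelong_of_pos {x : Fin n → ℝ} (hx : ∀ i, 0 < x i) :
    refinedLelong φ x = kiselmanInterior φ x := if_pos hx

lemma mem_closure_orthant {x : Fin n → ℝ} (hx : ∀ i, 0 ≤ x i) :
    x ∈ closure {y : Fin n → ℝ | ∀ i, 0 < y i} := by
  have h : Tendsto (fun ε : ℝ => fun i => x i + ε) (𝓝[>] 0) (𝓝 x) := by
    have : Continuous (fun ε : ℝ => fun i => x i + ε) := by fun_prop
    simpa using (this.tendsto 0).mono_left nhdsWithin_le_nhds
  exact mem_closure_of_tendsto h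
    (eventually_mem_nhdsWithin.mono fun ε hε i => add_pos_of_nonneg_of_pos (hx i) hε)

/-- At a boundary point the upper limit is a true limit, because `orthantExt` is continuous and
agrees with `kiselmanInterior` inside. The properties of `ν` on the closed orthant follow from those
of the extension. -/
lemma refinedLelong_eq_orthantExt (hφ : IsPlurisubharmonicOn φ (polydisc n)) (hT : IsToric φ)
    {x : Fin n → ℝ} (hx : ∀ i, 0 ≤ x i) :
    refinedLelong φ x = orthantExt (kiselmanInterior φ) x := by
  have hmono := fun x y => kiselmanInterior_mono (x := x) (y := y) hφ hT
  have hsmul := fun x c => kiselmanInterior_smul (x := x) (c := c) hφ hT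
  by_cases hpos : ∀ i, 0 < x i
  · rw [refinedLelong_of_pos hpos, orthantExt_eq hmono hsmul hpos]
  · rw [refinedLelong, if_neg hpos]
    have : (𝓝[{y : Fin n → ℝ | ∀ i, 0 < y i}] x).NeBot :=
      mem_closure_iff_nhdsWithin_neBot.1 (mem_closure_orthant hx)
    refine Tendsto.limsup_eq ?_
    have h := (orthantExt_continuousWithinAt hmono hsmul hx).mono
      (fun y (hy : ∀ i, 0 < y i) i => (hy i).le)
    exact h.congr' (eventually_mem_nhdsWithin.mono fun y hy => orthantExt_eq hmono hsmul hy)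

lemma refinedLelong_mono (hφ : IsPlurisubharmonicOn φ (polydisc n)) (hT : IsToric φ)
    {x y : Fin n → ℝ} (hx : ∀ i, 0 ≤ x i) (hxy : x ≤ y) :
    refinedLelong φ x ≤ refinedLelong φ y := by
  rw [refinedLelong_eq_orthantExt hφ hT hx,
    refinedLelong_eq_orthantExt hφ hT fun i => (hx i).trans (hxy i)]
  exact orthantExt_mono (fun x y => kiselmanInterior_mono (x := x) (y := y) hφ hT) hx hxy

lemma refinedLelong_smul (hφ : IsPlurisubharmonicOn φ (polydisc n)) (hT : IsToric φ)
    {x : Fin n → ℝ} (hx : ∀ i, 0 ≤ x i) {c : ℝ} (hc : 0 < c) :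
    refinedLelong φ (c • x) = ENNReal.ofReal c * refinedLelong φ x := by
  rw [refinedLelong_eq_orthantExt hφ hT hx,
    refinedLelong_eq_orthantExt hφ hT (x := c • x) fun i => mul_nonneg hc.le (hx i)]
  exact orthantExt_smul (fun x c => kiselmanInterior_smul (x := x) (c := c) hφ hT) hx hc

lemma refinedLelong_add (hφ : IsPlurisubharmonicOn φ (polydisc n)) (hT : IsToric φ)
    {x y : Fin n → ℝ} (hx : ∀ i, 0 ≤ x i) (hy : ∀ i, 0 ≤ y i) :
    refinedLelong φ x + refinedLelong φ y ≤ refinedLelong φ (x + y) := by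
  rw [refinedLelong_eq_orthantExt hφ hT hx, refinedLelong_eq_orthantExt hφ hT hy,
    refinedLelong_eq_orthantExt hφ hT (x := x + y) fun i => add_nonneg (hx i) (hy i)]
  exact orthantExt_add (fun x y => kiselmanInterior_add (x := x) (y := y) hφ hT) hx hy

lemma refinedLelong_continuousOn (hφ : IsPlurisubharmonicOn φ (polydisc n)) (hT : IsToric φ) :
    ContinuousOn (refinedLelong φ) {x : Fin n → ℝ | ∀ i, 0 ≤ x i} := fun _ hx =>
  (orthantExt_continuousWithinAt (fun x y => kiselmanInterior_mono (x := x) (y := y) hφ hT)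
    (fun x c => kiselmanInterior_smul (x := x) (c := c) hφ hT) hx).congr
    (fun _ hy => refinedLelong_eq_orthantExt hφ hT hy) (refinedLelong_eq_orthantExt hφ hT hx)

lemma refinedLelong_ne_top (hφ : IsPlurisubharmonicOn φ (polydisc n)) (hT : IsToric φ)
    (hfin : ∀ u : Fin n → ℝ, (∀ i, u i < 0) → φ (expPoint u) ≠ ⊥)
    {x : Fin n → ℝ} (hx : ∀ i, 0 ≤ x i) : refinedLelong φ x ≠ ⊤ := by
  have hpos : ∀ i, 0 < x i + 1 := fun i => add_pos_of_nonneg_of_pos (hx i) one_pos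
  obtain ⟨L, -, hL⟩ := exists_tendsto_logProfile hφ hT hfin hpos
  refine ne_top_of_le_ne_top ?_
    (refinedLelong_mono hφ hT hx (y := fun i => x i + 1) fun i => by simp)
  rw [refinedLelong_of_pos hpos, kiselmanInterior_of_tendsto hφ hT hfin hpos hL]
  exact ENNReal.ofReal_ne_top

lemma refinedLelong_eq_top (hφ : IsPlurisubharmonicOn φ (polydisc n)) (hT : IsToric φ)
    (hbot : ∀ u : Fin n → ℝ, (∀ i, u i < 0) → φ (expPoint u) = ⊥)
    {x : Fin n → ℝ} (hx : ∀ i, 0 ≤ x i) : refinedLelong φ x = ⊤ := by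
  rw [refinedLelong_eq_orthantExt hφ hT hx, orthantExt, iInf_eq_top]
  exact fun ε => kiselmanInterior_of_bot hT hbot fun i => add_pos_of_nonneg_of_pos (hx i) ε.2

end

/-! ### The sandwich theorem and the gauge -/

section

variable {n : ℕ}

/-- The sandwich theorem: between a superlinear function on a convex cone and a sublinear function
on the whole space there is a linear one. -/
lemma exists_linearMap_between {E : Type*} [AddCommGroup E] [Module ℝ E] {P : Set E} {ψ q : E → ℝ}
    (h0 : (0 : E) ∈ P) (hPadd : ∀ x ∈ P, ∀ y ∈ P, x + y ∈ P)
    (hPsmul : ∀ c : ℝ, 0 < c → ∀ x ∈ P, c • x ∈ P)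
    (hψadd : ∀ x y, ψ (x + y) ≤ ψ x + ψ y) (hψsmul : ∀ c : ℝ, 0 < c → ∀ x, ψ (c • x) = c * ψ x)
    (hqadd : ∀ x ∈ P, ∀ y ∈ P, q x + q y ≤ q (x + y))
    (hqsmul : ∀ c : ℝ, 0 < c → ∀ x ∈ P, q (c • x) = c * q x) (hle : ∀ x ∈ P, q x ≤ ψ x) :
    ∃ l : E →ₗ[ℝ] ℝ, (∀ x, l x ≤ ψ x) ∧ ∀ x ∈ P, q x ≤ l x := by
  have hne : Nonempty P := ⟨⟨0, h0⟩⟩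
  have hq0 : q 0 = 0 := by
    have := hqsmul 2 two_pos 0 h0
    rw [smul_zero] at this
    linarith
  have hψ0 : ψ 0 = 0 := by
    have := hψsmul 2 two_pos 0
    rw [smul_zero] at this
    linarith
  -- This infimal convolution is sublinear, and finite because `q ≤ ψ` on `P`. A linear `l ≤ p` has
  -- both properties: `z = 0` gives `l ≤ ψ`, and evaluating at `-x` with `z = x` gives `q x ≤ l x`.
  set p : E → ℝ := fun x => ⨅ z : P, (ψ (x + z) - q z) with hp
  have hbdd : ∀ x, BddBelow (Set.range fun z : P => ψ (x + z) - q z) := by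
    intro x
    refine ⟨-ψ (-x), ?_⟩
    rintro _ ⟨z, rfl⟩
    have h1 := hψadd (x + z) (-x)
    rw [add_neg_cancel_comm] at h1
    have h2 := hle z z.2
    dsimp only
    linarith
  have hple : ∀ x, ∀ z ∈ P, p x ≤ ψ (x + z) - q z := fun x z hz => ciInf_le (hbdd x) ⟨z, hz⟩
  have hpsmul_le : ∀ c : ℝ, 0 < c → ∀ x, p (c • x) ≤ c * p x := by
    intro c hc x
    rw [← div_le_iff₀' hc]
    refine le_ciInf fun z => ?_
    rw [div_le_iff₀' hc]
    refine (hple _ _ (hPsmul c hc z z.2)).trans (le_of_eq ?_)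
    rw [← smul_add, hψsmul c hc, hqsmul c hc z z.2]
    ring
  have hpsmul : ∀ c : ℝ, 0 < c → ∀ x, p (c • x) = c * p x := by
    intro c hc x
    refine le_antisymm (hpsmul_le c hc x) ?_
    have := hpsmul_le c⁻¹ (inv_pos.2 hc) (c • x)
    rw [inv_smul_smul₀ hc.ne', ← div_eq_inv_mul, le_div_iff₀' hc] at this
    exact this
  have hpadd : ∀ x y, p (x + y) ≤ p x + p y := by
    intro x y
    refine le_ciInf_add_ciInf fun z w => ?_
    have h1 := hple (x + y) _ (hPadd z z.2 w w.2)
    have h2 := hψadd (x + z) (y + w)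
    have h3 := hqadd z z.2 w w.2
    rw [add_add_add_comm] at h2
    linarith
  have hp0 : p 0 = 0 := by
    have := hpsmul 2 two_pos 0
    rw [smul_zero] at this
    linarith
  obtain ⟨l, -, hl⟩ := exists_extension_of_le_sublinear (⊥ : E →ₗ.[ℝ] ℝ) p hpsmul hpadd (by
    rintro ⟨x, hx⟩
    have hx0 : x = 0 := (Submodule.mem_bot ℝ).1 hx
    subst hx0
    rw [hp0]
    exact (map_zero (⊥ : E →ₗ.[ℝ] ℝ).toFun).le)
  refine ⟨l, fun x => (hl x).trans ?_, fun x hx => ?_⟩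
  · simpa [hq0] using hple x 0 h0
  · have h1 := (hl (-x)).trans (hple (-x) x hx)
    rw [map_neg, neg_add_cancel, hψ0] at h1
    linarith

lemma iInf_le_apply (x : Fin n → ℝ) (i : Fin n) : ⨅ i, x i ≤ x i :=
  ciInf_le (Set.finite_range x).bddBelow i

lemma apply_le_iSup (x : Fin n → ℝ) (i : Fin n) : x i ≤ ⨆ i, x i :=
  le_ciSup (Set.finite_range x).bddAbove i

lemma iSup_pos_of_mem {y : Fin n → ℝ} (hy : y ∈ stdSimplex ℝ (Fin n)) : 0 < ⨆ i, y i := by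
  by_contra hcon
  have : ∑ i, y i ≤ 0 := Finset.sum_nonpos fun i _ => (apply_le_iSup y i).trans (not_lt.1 hcon)
  linarith [hy.2]

/-- The sublinear function `∑ xᵢ + (T - n) min xᵢ`. -/
noncomputable def weightGauge (n : ℕ) (T : ℝ) (x : Fin n → ℝ) : ℝ :=
  ∑ i, x i + (T - n) * ⨅ i, x i

lemma weightGauge_add [NeZero n] {T : ℝ} (hT : T ≤ n) (x y : Fin n → ℝ) :
    weightGauge n T (x + y) ≤ weightGauge n T x + weightGauge n T y := by
  have h : (⨅ i, x i) + (⨅ i, y i) ≤ ⨅ i, (x + y) i :=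
    le_ciInf fun i => add_le_add (iInf_le_apply x i) (iInf_le_apply y i)
  have h2 := mul_le_mul_of_nonpos_left h (sub_nonpos.2 hT)
  simp only [weightGauge, Pi.add_apply, Finset.sum_add_distrib] at h2 ⊢
  linarith

lemma weightGauge_smul {T : ℝ} {c : ℝ} (hc : 0 ≤ c) (x : Fin n → ℝ) :
    weightGauge n T (c • x) = c * weightGauge n T x := by
  have h : ⨅ i, (c • x) i = c * ⨅ i, x i := (Real.mul_iInf_of_nonneg hc x).symm
  rw [weightGauge, weightGauge, h, mul_add, Finset.mul_sum]
  simp only [Pi.smul_apply, smul_eq_mul]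
  ring

lemma weightGauge_of_mem {T : ℝ} {x : Fin n → ℝ} (hx : x ∈ stdSimplex ℝ (Fin n)) :
    weightGauge n T x = 1 + (T - n) * ⨅ i, x i := by
  rw [weightGauge, hx.2]

lemma weightGauge_le_sum {T : ℝ} (hT : T ≤ n) {x : Fin n → ℝ} (hx : ∀ i, 0 ≤ x i) :
    weightGauge n T x ≤ ∑ i, x i := by
  have := mul_nonpos_of_nonpos_of_nonneg (sub_nonpos.2 hT) (Real.iInf_nonneg hx)
  rw [weightGauge]
  linarith

lemma mul_iInf_le_sum [NeZero n] (x : Fin n → ℝ) : n * ⨅ i, x i ≤ ∑ i, x i := by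
  have := Finset.card_nsmul_le_sum Finset.univ x (⨅ i, x i) fun i _ => iInf_le_apply x i
  simpa using this

lemma weightGauge_pos [NeZero n] {T : ℝ} (hT0 : 0 < T) {x : Fin n → ℝ} (hx : x ∈ stdSimplex ℝ (Fin n)) :
    0 < weightGauge n T x := by
  have h1 := mul_iInf_le_sum x
  have h2 := Real.iInf_nonneg hx.1
  have hs := hx.2
  rw [weightGauge]
  rcases h2.eq_or_lt with h | h
  · rw [← h]
    linarith
  · nlinarith

lemma continuous_weightGauge [NeZero n] {T : ℝ} : Continuous (weightGauge n T) := by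
  have h : Continuous fun x : Fin n → ℝ => ⨅ i, x i := by
    have h2 : Continuous fun x : Fin n → ℝ => Finset.univ.inf' Finset.univ_nonempty x :=
      Continuous.finset_inf'_apply _ fun i _ => continuous_apply i
    simpa only [Finset.inf'_univ_eq_ciInf] using h2
  unfold weightGauge
  fun_prop

/-- A point `y` of the simplex, rescaled by `min T (1 / max yᵢ)`, lies below the gauge. -/
lemma min_mul_sum_le {T : ℝ} (hT0 : 0 < T) {x y : Fin n → ℝ} (hx : ∀ i, 0 ≤ x i)
    (hy : y ∈ stdSimplex ℝ (Fin n)) :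
    min T (1 / ⨆ i, y i) * ∑ i, x i * y i ≤ weightGauge n T x := by
  set m := min T (1 / ⨆ i, y i) with hm
  set μ := ⨅ i, x i with hμ
  have hsup := iSup_pos_of_mem hy
  have hm0 : 0 ≤ m := le_min hT0.le (by positivity)
  have h1 : ∀ i, m * y i ≤ 1 := fun i => by
    calc m * y i ≤ (1 / ⨆ i, y i) * ⨆ i, y i :=
          mul_le_mul (min_le_right _ _) (apply_le_iSup y i) (hy.1 i) (by positivity)
      _ = 1 := by field_simp
  -- Splitting `x i = (x i - μ) + μ` uses the two bounds on `m` separately: `m * y i ≤ 1` for the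
  -- nonnegative part and `m ≤ T` for the constant part.
  have h2 : m * ∑ i, x i * y i = ∑ i, (x i - μ) * (m * y i) + m * μ * ∑ i, y i := by
    rw [Finset.mul_sum, Finset.mul_sum, ← Finset.sum_add_distrib]
    exact Finset.sum_congr rfl fun i _ => by ring
  have h3 : ∑ i, (x i - μ) * (m * y i) ≤ ∑ i, (x i - μ) :=
    Finset.sum_le_sum fun i _ =>
      mul_le_of_le_one_right (sub_nonneg.2 (iInf_le_apply x i)) (h1 i)
  have h4 : m * μ ≤ T * μ := mul_le_mul_of_nonneg_right (min_le_left _ _) (Real.iInf_nonneg hx)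
  rw [h2, hy.2, weightGauge]
  simp only [Finset.sum_sub_distrib, Finset.sum_const, Finset.card_univ, Fintype.card_fin,
    nsmul_eq_mul] at h3
  linarith

end

/-! ### Duality between the minimum and the maximum -/

section

variable {n : ℕ} {φ : (Fin n → ℂ) → EReal}

/-- The function minimized over the simplex. -/
noncomputable def gaugeQuotient (φ : (Fin n → ℂ) → EReal) (T : ℝ) (x : Fin n → ℝ) : ℝ≥0∞ :=
  ENNReal.ofReal (1 + (T - n) * ⨅ i, x i) / refinedLelong φ x

lemma gaugeQuotient_of_mem {T : ℝ} {x : Fin n → ℝ} (hx : x ∈ stdSimplex ℝ (Fin n)) :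
    gaugeQuotient φ T x = ENNReal.ofReal (weightGauge n T x) / refinedLelong φ x := by
  rw [gaugeQuotient, weightGauge_of_mem hx]

/-- Division in `[0, ∞]` is continuous here because the numerator is positive and finite, which
excludes `0 / 0` and `∞ / ∞`. -/
lemma continuousOn_gaugeQuotient [NeZero n] (hφ : IsPlurisubharmonicOn φ (polydisc n))
    (hT : IsToric φ) {T : ℝ} (hT0 : 0 < T) :
    ContinuousOn (gaugeQuotient φ T) (stdSimplex ℝ (Fin n)) := by
  refine ContinuousOn.congr (f := fun x => ENNReal.ofReal (weightGauge n T x) / refinedLelong φ x)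
    (fun x hx => ?_) fun x hx => gaugeQuotient_of_mem hx
  refine ENNReal.Tendsto.div ?_ (Or.inl ?_) ?_ (Or.inr ENNReal.ofReal_ne_top)
  · exact ((ENNReal.continuous_ofReal.comp continuous_weightGauge).tendsto x).mono_left
      nhdsWithin_le_nhds
  · simpa using weightGauge_pos hT0 hx
  · exact (refinedLelong_continuousOn hφ hT x hx.1).mono fun y hy => hy.1

lemma exists_isMin_gaugeQuotient [NeZero n] (hφ : IsPlurisubharmonicOn φ (polydisc n))
    (hT : IsToric φ) {T : ℝ} (hT0 : 0 < T) :
    ∃ x ∈ stdSimplex ℝ (Fin n), ∀ y ∈ stdSimplex ℝ (Fin n),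
      gaugeQuotient φ T x ≤ gaugeQuotient φ T y := by
  obtain ⟨x, hx, hmin⟩ := (isCompact_stdSimplex ℝ (Fin n)).exists_isMinOn
    ⟨_, single_mem_stdSimplex ℝ (0 : Fin n)⟩ (continuousOn_gaugeQuotient hφ hT hT0)
  exact ⟨x, hx, fun y hy => hmin hy⟩

/-- A lower bound for the quotient on the open simplex holds on the closed simplex. -/
lemma le_gaugeQuotient_of_interior [NeZero n] (hφ : IsPlurisubharmonicOn φ (polydisc n))
    (hT : IsToric φ) {T : ℝ} (hT0 : 0 < T) {C : ℝ≥0∞}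
    (h : ∀ x ∈ stdSimplex ℝ (Fin n), (∀ i, 0 < x i) → C ≤ gaugeQuotient φ T x)
    {x : Fin n → ℝ} (hx : x ∈ stdSimplex ℝ (Fin n)) : C ≤ gaugeQuotient φ T x := by
  have hn : (0 : ℝ) < n := Nat.cast_pos.2 (NeZero.pos n)
  set b : Fin n → ℝ := fun _ => (n : ℝ)⁻¹ with hb
  have hbS : b ∈ stdSimplex ℝ (Fin n) := ⟨fun i => by positivity, by simp [hb, hn.ne']⟩
  have hmem : ∀ᶠ ε : ℝ in 𝓝[>] 0, 0 < ε ∧ (1 - ε) • x + ε • b ∈ stdSimplex ℝ (Fin n) := by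
    filter_upwards [self_mem_nhdsWithin, nhdsWithin_le_nhds (gt_mem_nhds one_pos)] with ε h0 h1
    exact ⟨h0, convex_stdSimplex ℝ (Fin n) hx hbS (sub_nonneg.2 (le_of_lt h1)) (le_of_lt h0) (by simp)⟩
  have hlim : Tendsto (fun ε : ℝ => (1 - ε) • x + ε • b) (𝓝[>] 0) (𝓝[stdSimplex ℝ (Fin n)] x) := by
    refine tendsto_nhdsWithin_iff.2 ⟨?_, hmem.mono fun ε hε => hε.2⟩
    have : Continuous (fun ε : ℝ => (1 - ε) • x + ε • b) := by fun_prop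
    simpa using (this.tendsto 0).mono_left nhdsWithin_le_nhds
  refine ge_of_tendsto ((continuousOn_gaugeQuotient hφ hT hT0 x hx).tendsto.comp hlim) ?_
  filter_upwards [hmem, nhdsWithin_le_nhds (gt_mem_nhds one_pos)] with ε hε h1
  refine h _ hε.2 fun i => ?_
  have e1 := mul_nonneg (sub_nonneg.2 (le_of_lt h1)) (hx.1 i)
  have e2 := mul_pos hε.1 (inv_pos.2 hn)
  simp only [hb, Pi.add_apply, Pi.smul_apply, smul_eq_mul]
  linarith

/-- Weak duality: rescaling `x` by `d = ∑ x i * y i` makes it admissible for the dual function, so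
`h y ≤ d / ν x`, and `min_mul_sum_le` bounds `d` times the other factor. For interior `x` the
pairing `d` is positive. -/
lemma dualLelong_mul_le [NeZero n] (hφ : IsPlurisubharmonicOn φ (polydisc n))
    (hT : IsToric φ) {T : ℝ} (hT0 : 0 < T) {x y : Fin n → ℝ}
    (hx : x ∈ stdSimplex ℝ (Fin n)) (hy : y ∈ stdSimplex ℝ (Fin n)) :
    dualLelong φ y * ENNReal.ofReal (min T (1 / ⨆ i, y i)) ≤ gaugeQuotient φ T x := by
  refine le_gaugeQuotient_of_interior hφ hT hT0 (fun x hx hpos => ?_) hx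
  have hsup := iSup_pos_of_mem hy
  set m := min T (1 / ⨆ i, y i) with hm
  set d := ∑ i, x i * y i with hd
  have hd0 : 0 < d := by
    refine (Finset.sum_nonneg fun i _ => mul_nonneg (hx.1 i) (hy.1 i)).lt_of_ne fun h => ?_
    have h2 := (Finset.sum_eq_zero_iff_of_nonneg
      fun i _ => mul_nonneg (hx.1 i) (hy.1 i)).1 h.symm
    have h3 : ∑ i, y i = 0 := Finset.sum_eq_zero fun i hi =>
      (mul_eq_zero.1 (h2 i hi)).resolve_left (hpos i).ne'
    rw [hy.2] at h3
    exact one_ne_zero h3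
  have hdual : dualLelong φ y ≤ (refinedLelong φ (d⁻¹ • x))⁻¹ := by
    refine iInf₂_le (d⁻¹ • x) ⟨fun i => mul_nonneg (inv_pos.2 hd0).le (hx.1 i), ?_⟩
    simp only [Pi.smul_apply, smul_eq_mul, mul_assoc, ← Finset.mul_sum]
    exact inv_mul_cancel₀ hd0.ne'
  rw [refinedLelong_smul hφ hT hx.1 (inv_pos.2 hd0), ENNReal.mul_inv
    (Or.inl (by simpa using hd0)) (Or.inl ENNReal.ofReal_ne_top), ENNReal.ofReal_inv_of_pos hd0,
    inv_inv] at hdual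
  rw [gaugeQuotient_of_mem hx, ENNReal.div_eq_inv_mul]
  refine (mul_le_mul_left hdual _).trans ?_
  rw [mul_comm (ENNReal.ofReal d), mul_assoc, ← ENNReal.ofReal_mul hd0.le]
  gcongr
  rw [mul_comm]
  exact min_mul_sum_le hT0 hx.1 hy

/-- The duality between the minimum of the quotient and the maximum of the dual function. -/
lemma exists_le_dualLelong_mul [NeZero n] (hφ : IsPlurisubharmonicOn φ (polydisc n))
    (hT : IsToric φ) {T : ℝ} (hT0 : 0 < T) (hTn : T ≤ n) {C : ℝ≥0∞}
    (hC : ∀ x ∈ stdSimplex ℝ (Fin n), C ≤ gaugeQuotient φ T x) :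
    ∃ y ∈ stdSimplex ℝ (Fin n),
      C ≤ dualLelong φ y * ENNReal.ofReal (min T (1 / ⨆ i, y i)) := by
  have he : Pi.single (0 : Fin n) (1 : ℝ) ∈ stdSimplex ℝ (Fin n) := single_mem_stdSimplex ℝ 0
  by_cases hzero : ∀ x ∈ stdSimplex ℝ (Fin n), refinedLelong φ x = 0
  · refine ⟨_, he, ?_⟩
    have hdual : dualLelong φ (Pi.single (0 : Fin n) (1 : ℝ)) = ⊤ := by
      simp only [dualLelong, iInf_eq_top, ENNReal.inv_eq_top]
      rintro a ⟨ha, hsum⟩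
      have hs : 0 < ∑ i, a i := by
        refine (Finset.sum_nonneg fun i _ => ha i).lt_of_ne fun h => ?_
        have h2 := (Finset.sum_eq_zero_iff_of_nonneg fun i _ => ha i).1 h.symm
        simp [h2 0 (Finset.mem_univ _), Pi.single_apply] at hsum
      have hmem : (∑ i, a i)⁻¹ • a ∈ stdSimplex ℝ (Fin n) := by
        refine ⟨fun i => mul_nonneg (inv_pos.2 hs).le (ha i), ?_⟩
        simp only [Pi.smul_apply, smul_eq_mul, ← Finset.mul_sum]
        exact inv_mul_cancel₀ hs.ne'
      have h3 := refinedLelong_smul hφ hT hmem.1 hs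
      rwa [smul_inv_smul₀ hs.ne', hzero _ hmem, mul_zero] at h3
    have hsup := iSup_pos_of_mem he
    rw [hdual, ENNReal.top_mul]
    · exact le_top
    · simpa using ⟨hT0, hsup⟩
  push Not at hzero
  obtain ⟨x₁, hx₁, hNx₁⟩ := hzero
  have hCtop : C ≠ ⊤ := by
    refine ne_top_of_le_ne_top ?_ (hC x₁ hx₁)
    exact ENNReal.div_ne_top ENNReal.ofReal_ne_top hNx₁
  rcases eq_or_ne C 0 with rfl | hC0
  · exact ⟨_, he, zero_le⟩
  have hfin : ∀ x : Fin n → ℝ, (∀ i, 0 ≤ x i) → refinedLelong φ x ≠ ⊤ := by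
    rcases bot_or_finite hφ hT with hbot | hfin
    · have := hC x₁ hx₁
      rw [gaugeQuotient, refinedLelong_eq_top hφ hT hbot hx₁.1, ENNReal.div_top] at this
      exact absurd (le_antisymm this zero_le) hC0
    · exact fun x hx => refinedLelong_ne_top hφ hT hfin hx
  set M := C.toReal with hM
  have hM0 : 0 < M := ENNReal.toReal_pos hC0 hCtop
  set P : Set (Fin n → ℝ) := {x | ∀ i, 0 ≤ x i} with hP
  have hsmulN : ∀ c : ℝ, 0 < c → ∀ x ∈ P,
      (refinedLelong φ (c • x)).toReal = c * (refinedLelong φ x).toReal := fun c hc x hx => by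
    rw [refinedLelong_smul hφ hT hx hc, ENNReal.toReal_mul, ENNReal.toReal_ofReal hc.le]
  have hle : ∀ x ∈ P, M * (refinedLelong φ x).toReal ≤ weightGauge n T x := by
    intro x hx
    rcases (Finset.sum_nonneg fun i _ => hx i : 0 ≤ ∑ i, x i).eq_or_lt with h | hs
    · have hx0 : x = 0 := by
        ext i
        exact (Finset.sum_eq_zero_iff_of_nonneg fun i _ => hx i).1 h.symm i (Finset.mem_univ i)
      have h2 := hsmulN 2 two_pos x hx
      have h3 := weightGauge_smul (T := T) two_pos.le x
      rw [hx0, smul_zero] at h2 h3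
      rw [hx0]
      have : (refinedLelong φ (0 : Fin n → ℝ)).toReal = 0 := by linarith
      rw [this]
      linarith
    · set z := (∑ i, x i)⁻¹ • x with hz
      have hmem : z ∈ stdSimplex ℝ (Fin n) := by
        refine ⟨fun i => mul_nonneg (inv_pos.2 hs).le (hx i), ?_⟩
        simp only [hz, Pi.smul_apply, smul_eq_mul, ← Finset.mul_sum]
        exact inv_mul_cancel₀ hs.ne'
      have hxz : x = (∑ i, x i) • z := by rw [hz, smul_inv_smul₀ hs.ne']
      have h1 := hC z hmem
      rw [gaugeQuotient_of_mem hmem] at h1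
      have h2 := ENNReal.mul_le_of_le_div h1
      have h3 := ENNReal.toReal_mono ENNReal.ofReal_ne_top h2
      rw [ENNReal.toReal_mul, ENNReal.toReal_ofReal (weightGauge_pos hT0 hmem).le] at h3
      rw [hxz, hsmulN _ hs z hmem.1, weightGauge_smul hs.le]
      calc _ = (∑ i, x i) * (M * (refinedLelong φ z).toReal) := by ring
        _ ≤ _ := mul_le_mul_of_nonneg_left h3 hs.le
  -- The lower bound `C` says that the superlinear function `M * ν` lies below the gauge on the
  -- orthant; a linear form fits between them.
  obtain ⟨l, hl1, hl2⟩ := exists_linearMap_between (P := P) (ψ := weightGauge n T)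
    (q := fun x => M * (refinedLelong φ x).toReal) (fun i => le_rfl)
    (fun x hx y hy i => add_nonneg (hx i) (hy i))
    (fun c hc x hx i => mul_nonneg hc.le (hx i)) (weightGauge_add hTn)
    (fun c hc x => weightGauge_smul hc.le x)
    (fun x hx y hy => by
      rw [← mul_add, ← ENNReal.toReal_add (hfin x hx) (hfin y hy)]
      exact mul_le_mul_of_nonneg_left (ENNReal.toReal_mono (hfin _ fun i => add_nonneg (hx i) (hy i))
        (refinedLelong_add hφ hT hx hy)) hM0.le)
    (fun c hc x hx => by
      rw [hsmulN c hc x hx]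
      ring) hle
  set w : Fin n → ℝ := fun i => l (Pi.single i 1) with hw
  have hsingle : ∀ i : Fin n, (Pi.single i (1 : ℝ) : Fin n → ℝ) ∈ P := fun i j => by
    rcases eq_or_ne j i with rfl | h
    · simp
    · simp [h]
  have hlw : ∀ x, l x = ∑ i, x i * w i := fun x => by
    rw [LinearMap.pi_apply_eq_sum_univ l x]
    refine Finset.sum_congr rfl fun i _ => ?_
    simp only [hw, smul_eq_mul]
    congr 2
    ext j
    simp [Pi.single_apply, eq_comm]
  have hw0 : ∀ i, 0 ≤ w i := fun i =>
    (mul_nonneg hM0.le ENNReal.toReal_nonneg).trans (hl2 _ (hsingle i))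
  -- Testing `l` against the gauge on unit vectors bounds each coefficient by `1`; testing on the
  -- all-ones vector, where the gauge is `T`, bounds their sum. These become the two terms of the
  -- minimum.
  have hw1 : ∀ i, w i ≤ 1 := fun i => by
    refine (hl1 _).trans ((weightGauge_le_sum hTn (hsingle i)).trans (le_of_eq ?_))
    simp
  set W := ∑ i, w i with hW
  have hWT : W ≤ T := by
    have h1 := hl1 fun _ => 1
    rw [hlw] at h1
    simp only [one_mul, weightGauge, ciInf_const, Finset.sum_const, Finset.card_univ,
      Fintype.card_fin, nsmul_eq_mul, mul_one] at h1
    linarith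
  have hW0 : 0 < W := by
    refine (Finset.sum_nonneg fun i _ => hw0 i).lt_of_ne fun h => ?_
    have h2 := (Finset.sum_eq_zero_iff_of_nonneg fun i _ => hw0 i).1 h.symm
    have h3 := hl2 x₁ hx₁.1
    rw [hlw, Finset.sum_eq_zero fun i hi => by rw [h2 i hi, mul_zero]] at h3
    have := mul_pos hM0 (ENNReal.toReal_pos hNx₁ (hfin x₁ hx₁.1))
    linarith
  set y := W⁻¹ • w with hy
  have hyS : y ∈ stdSimplex ℝ (Fin n) := by
    refine ⟨fun i => mul_nonneg (inv_pos.2 hW0).le (hw0 i), ?_⟩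
    simp only [hy, Pi.smul_apply, smul_eq_mul, ← Finset.mul_sum]
    exact inv_mul_cancel₀ hW0.ne'
  have hsup := iSup_pos_of_mem hyS
  have hmin : W ≤ min T (1 / ⨆ i, y i) := by
    refine le_min hWT ?_
    rw [le_div_iff₀ hsup, ← le_div_iff₀' hW0]
    refine ciSup_le fun i => ?_
    simp only [hy, Pi.smul_apply, smul_eq_mul]
    rw [inv_mul_eq_div]
    gcongr
    exact hw1 i
  refine ⟨y, hyS, ?_⟩
  have hdual : ENNReal.ofReal (M / W) ≤ dualLelong φ y := by
    refine le_iInf₂ fun a ha => ?_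
    rw [ENNReal.le_inv_iff_mul_le, ← ENNReal.ofReal_toReal (hfin a ha.1),
      ← ENNReal.ofReal_mul (by positivity), ENNReal.ofReal_le_one]
    have h1 := hl2 a ha.1
    rw [hlw] at h1
    have h2 : ∑ i, a i * w i = W := by
      have h3 : ∑ i, a i * w i = W * ∑ i, a i * y i := by
        rw [Finset.mul_sum]
        refine Finset.sum_congr rfl fun i _ => ?_
        simp only [hy, Pi.smul_apply, smul_eq_mul]
        field_simp
      rw [h3, ha.2, mul_one]
    rw [h2] at h1
    rw [div_mul_eq_mul_div, div_le_one hW0]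
    exact h1
  calc C = ENNReal.ofReal M := (ENNReal.ofReal_toReal hCtop).symm
    _ = ENNReal.ofReal (M / W) * ENNReal.ofReal W := by
      rw [← ENNReal.ofReal_mul (by positivity), div_mul_cancel₀ _ hW0.ne']
    _ ≤ _ := mul_le_mul' hdual (ENNReal.ofReal_le_ofReal hmin)

/-- Both formulas hold for a number that lies below the quotient and above every `c` which lies
strictly below it. -/
lemma isLeast_and_isGreatest [NeZero n] (hφ : IsPlurisubharmonicOn φ (polydisc n))
    (hT : IsToric φ) {T : ℝ} (hT0 : 0 < T) (hTn : T ≤ n) {C : ℝ≥0∞}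
    (hle : ∀ x ∈ stdSimplex ℝ (Fin n), (∀ i, 0 < x i) → C ≤ gaugeQuotient φ T x)
    (hge : ∀ c : ℝ, 0 < c →
      (∀ x ∈ stdSimplex ℝ (Fin n), ENNReal.ofReal c < gaugeQuotient φ T x) → ENNReal.ofReal c ≤ C) :
    IsLeast (gaugeQuotient φ T '' stdSimplex ℝ (Fin n)) C ∧
    IsGreatest ((fun x : Fin n → ℝ => dualLelong φ x * ENNReal.ofReal (min T (1 / ⨆ i, x i))) ''
      stdSimplex ℝ (Fin n)) C := by
  have hle' : ∀ x ∈ stdSimplex ℝ (Fin n), C ≤ gaugeQuotient φ T x := fun x hx =>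
    le_gaugeQuotient_of_interior hφ hT hT0 hle hx
  obtain ⟨x₀, hx₀, hmin⟩ := exists_isMin_gaugeQuotient hφ hT hT0
  have hC : C = gaugeQuotient φ T x₀ := by
    refine le_antisymm (hle' x₀ hx₀) (le_of_forall_lt fun b hb => ?_)
    obtain ⟨b', hbb', hb'⟩ := exists_between hb
    have hb'top : b' ≠ ⊤ := ne_top_of_lt hb'
    have hpos : 0 < b'.toReal := ENNReal.toReal_pos (ne_bot_of_gt hbb') hb'top
    refine hbb'.trans_le ?_
    rw [← ENNReal.ofReal_toReal hb'top]
    refine hge _ hpos fun x hx => ?_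
    rw [ENNReal.ofReal_toReal hb'top]
    exact hb'.trans_le (hmin x hx)
  refine ⟨⟨⟨x₀, hx₀, hC.symm⟩, ?_⟩, ?_, ?_⟩
  · rintro _ ⟨x, hx, rfl⟩
    exact hle' x hx
  · obtain ⟨y, hy, hyC⟩ := exists_le_dualLelong_mul hφ hT hT0 hTn hle'
    refine ⟨y, hy, le_antisymm ?_ hyC⟩
    rw [hC]
    exact dualLelong_mul_le hφ hT hT0 hx₀ hy
  · rintro _ ⟨y, hy, rfl⟩
    rw [hC]
    exact dualLelong_mul_le hφ hT hT0 hx₀ hy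

end

/-! ### Bounds for `φ` in all directions, and test sets -/

section

variable {n : ℕ} {φ : (Fin n → ℂ) → EReal}

lemma finite_of_lt_gaugeQuotient [NeZero n] (hφ : IsPlurisubharmonicOn φ (polydisc n))
    (hT : IsToric φ) {T : ℝ} {b : ℝ≥0∞}
    (h : ∀ x ∈ stdSimplex ℝ (Fin n), b < gaugeQuotient φ T x) :
    ∀ u : Fin n → ℝ, (∀ i, u i < 0) → φ (expPoint u) ≠ ⊥ := by
  rcases bot_or_finite hφ hT with hbot | hfin
  · have he : Pi.single (0 : Fin n) (1 : ℝ) ∈ stdSimplex ℝ (Fin n) := single_mem_stdSimplex ℝ 0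
    have := h _ he
    rw [gaugeQuotient, refinedLelong_eq_top hφ hT hbot he.1, ENNReal.div_top] at this
    exact absurd this not_lt_zero
  · exact hfin

/-- A strict bound for the quotient at a point of the simplex gives a bound for `φ` in all nearby
directions. -/
lemma exists_local_bound [NeZero n] (hφ : IsPlurisubharmonicOn φ (polydisc n))
    (hT : IsToric φ) (hfin : ∀ u : Fin n → ℝ, (∀ i, u i < 0) → φ (expPoint u) ≠ ⊥)
    {T c : ℝ} (hT0 : 0 < T) (hc : 0 < c) {x : Fin n → ℝ} (hx : x ∈ stdSimplex ℝ (Fin n))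
    (h : ENNReal.ofReal c < gaugeQuotient φ T x) :
    ∃ U ∈ 𝓝 x, ∃ R : ℝ, 0 < R ∧ ∃ δ : ℝ, 0 < δ ∧ ∀ y ∈ U, (∀ i, 0 < y i) → ∀ r, R ≤ r →
      -(c * logProfile φ ((-r) • y)) ≤ r * (weightGauge n T y - δ) := by
  have hNx := refinedLelong_ne_top hφ hT hfin hx.1
  have hlt : c * (refinedLelong φ x).toReal < weightGauge n T x := by
    rw [gaugeQuotient_of_mem hx] at h
    have h2 := ENNReal.mul_lt_of_lt_div h
    rw [← ENNReal.ofReal_toReal hNx, ← ENNReal.ofReal_mul hc.le] at h2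
    exact (ENNReal.ofReal_lt_ofReal_iff (weightGauge_pos hT0 hx)).1 h2
  -- A quarter of the gap: one `δ` pays for moving from `x` to `x'`, one for the variation of the
  -- gauge on the neighbourhood, one is the conclusion, and one is spare.
  set δ := (weightGauge n T x - c * (refinedLelong φ x).toReal) / 4 with hδ
  have hδ0 : 0 < δ := by rw [hδ]; linarith
  have hlim : Tendsto (fun ε : ℝ => c * (refinedLelong φ (fun i => x i + ε)).toReal) (𝓝[>] 0)
      (𝓝 (c * (refinedLelong φ x).toReal)) := by
    refine Tendsto.const_mul c ((ENNReal.tendsto_toReal hNx).comp ?_)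
    refine (refinedLelong_continuousOn hφ hT x hx.1).tendsto.comp (tendsto_nhdsWithin_iff.2 ⟨?_, ?_⟩)
    · have : Continuous (fun ε : ℝ => fun i => x i + ε) := by fun_prop
      simpa using (this.tendsto 0).mono_left nhdsWithin_le_nhds
    · exact eventually_mem_nhdsWithin.mono fun ε hε i =>
        (add_pos_of_nonneg_of_pos (hx.1 i) hε).le
  have hlt3 : c * (refinedLelong φ x).toReal < weightGauge n T x - 3 * δ := by
    rw [hδ]
    linarith
  have hev := (hlim.eventually (gt_mem_nhds hlt3)).and (eventually_mem_nhdsWithin (s := Set.Ioi (0 : ℝ)))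
  obtain ⟨ε, hε, hε0⟩ := hev.exists
  rw [Set.mem_Ioi] at hε0
  -- The limit defining `ν` exists only along interior directions, and `x` may be on the boundary.
  -- The interior direction `x'` dominates a neighbourhood of `x`, and monotonicity transfers its
  -- bound to all `y` there.
  set x' : Fin n → ℝ := fun i => x i + ε with hx'
  have hx'0 : ∀ i, 0 < x' i := fun i => add_pos_of_nonneg_of_pos (hx.1 i) hε0
  obtain ⟨L, hL0, hL⟩ := exists_tendsto_logProfile hφ hT hfin hx'0
  rw [refinedLelong_of_pos hx'0, kiselmanInterior_of_tendsto hφ hT hfin hx'0 hL,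
    ENNReal.toReal_ofReal hL0] at hε
  obtain ⟨R, hR⟩ := eventually_atTop.1 ((hL.const_mul c).eventually (gt_mem_nhds hε))
  have hU : ∀ᶠ y in 𝓝 x, (∀ i, y i < x' i) ∧ weightGauge n T x - δ < weightGauge n T y := by
    refine (eventually_all.2 fun i => ?_).and ?_
    · have : ContinuousAt (fun y : Fin n → ℝ => y i) x := continuousAt_apply i x
      exact this.eventually (gt_mem_nhds (by simp [hx', hε0]))
    · exact continuous_weightGauge.continuousAt.eventually (lt_mem_nhds (by linarith))
  refine ⟨_, hU, max R 1, by positivity, δ, hδ0, fun y hy hy0 r hr => ?_⟩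
  have hr0 : 0 < r := lt_of_lt_of_le one_pos ((le_max_right _ _).trans hr)
  have h1 := hR r ((le_max_left _ _).trans hr)
  rw [← mul_div_assoc, div_lt_iff₀ hr0] at h1
  have h2 : logProfile φ ((-r) • x') ≤ logProfile φ ((-r) • y) :=
    logProfile_mono hφ hT hfin (neg_smul_neg_of_pos hy0 hr0) fun i =>
      mul_le_mul_of_nonpos_left (hy.1 i).le (neg_nonpos.2 hr0.le)
  have h3 := mul_le_mul_of_nonneg_left h2 hc.le
  have h4 := mul_lt_mul_of_pos_left hy.2 hr0
  have h5 := mul_pos hr0 hδ0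
  linarith

/-- Compactness of the simplex patches the local bounds, and homogeneity of the gauge extends them
from the simplex to all `u` with large coordinates. -/
lemma exists_uniform_bound [NeZero n] (hφ : IsPlurisubharmonicOn φ (polydisc n))
    (hT : IsToric φ) {T c : ℝ} (hT0 : 0 < T) (hc : 0 < c)
    (h : ∀ x ∈ stdSimplex ℝ (Fin n), ENNReal.ofReal c < gaugeQuotient φ T x) :
    ∃ R : ℝ, 0 < R ∧ ∃ δ : ℝ, 0 < δ ∧ δ < 1 ∧ ∀ u : Fin n → ℝ, (∀ i, R ≤ u i) →
      -(c * logProfile φ (-u)) ≤ weightGauge n T u - δ * ∑ i, u i := by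
  have hfin := finite_of_lt_gaugeQuotient hφ hT h
  have hcpt : ∃ R : ℝ, 0 < R ∧ ∃ δ : ℝ, 0 < δ ∧ ∀ y ∈ stdSimplex ℝ (Fin n), (∀ i, 0 < y i) →
      ∀ r, R ≤ r → -(c * logProfile φ ((-r) • y)) ≤ r * (weightGauge n T y - δ) := by
    refine (isCompact_stdSimplex ℝ (Fin n)).induction_on (p := fun s => ∃ R : ℝ, 0 < R ∧
      ∃ δ : ℝ, 0 < δ ∧ ∀ y ∈ s, (∀ i, 0 < y i) →
      ∀ r, R ≤ r → -(c * logProfile φ ((-r) • y)) ≤ r * (weightGauge n T y - δ)) ?_ ?_ ?_ ?_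
    · exact ⟨1, one_pos, 1, one_pos, by simp⟩
    · rintro s t hst ⟨R, hR, δ, hδ, H⟩
      exact ⟨R, hR, δ, hδ, fun y hy => H y (hst hy)⟩
    · rintro s t ⟨R, hR, δ, hδ, H⟩ ⟨R', hR', δ', hδ', H'⟩
      refine ⟨max R R', lt_max_of_lt_left hR, min δ δ', lt_min hδ hδ', ?_⟩
      rintro y (hy | hy) hy0 r hr
      · have hr1 := (le_max_left _ _).trans hr
        refine (H y hy hy0 r hr1).trans ?_
        have := min_le_left δ δ'
        exact mul_le_mul_of_nonneg_left (by linarith) (by linarith)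
      · have hr1 := (le_max_right _ _).trans hr
        refine (H' y hy hy0 r hr1).trans ?_
        have := min_le_right δ δ'
        exact mul_le_mul_of_nonneg_left (by linarith) (by linarith)
    · intro x hx
      obtain ⟨U, hU, hb⟩ := exists_local_bound hφ hT hfin hT0 hc hx (h x hx)
      exact ⟨U, mem_nhdsWithin_of_mem_nhds hU, hb⟩
  obtain ⟨R, hR, δ, hδ, H⟩ := hcpt
  -- The cap at `1 / 2` keeps the later exponent `α = 2 * (1 - δ)` positive.
  refine ⟨R, hR, min δ (1 / 2), lt_min hδ (by norm_num),
    (min_le_right _ _).trans_lt (by norm_num), fun u hu => ?_⟩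
  have hu0 : ∀ i, 0 < u i := fun i => hR.trans_le (hu i)
  have hs : R ≤ ∑ i, u i :=
    (hu 0).trans (Finset.single_le_sum (fun i _ => (hu0 i).le) (Finset.mem_univ 0))
  have hs0 : 0 < ∑ i, u i := hR.trans_le hs
  set y := (∑ i, u i)⁻¹ • u with hy
  have hyS : y ∈ stdSimplex ℝ (Fin n) := by
    refine ⟨fun i => mul_nonneg (inv_pos.2 hs0).le (hu0 i).le, ?_⟩
    simp only [hy, Pi.smul_apply, smul_eq_mul, ← Finset.mul_sum]
    exact inv_mul_cancel₀ hs0.ne'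
  have huy : u = (∑ i, u i) • y := by rw [hy, smul_inv_smul₀ hs0.ne']
  have h1 := H y hyS (fun i => mul_pos (inv_pos.2 hs0) (hu0 i)) _ hs
  rw [neg_smul, ← huy] at h1
  have h2 : weightGauge n T u = (∑ i, u i) * weightGauge n T y := by
    conv_lhs => rw [huy]
    exact weightGauge_smul hs0.le y
  rw [h2]
  have h3 := mul_le_mul_of_nonneg_left (min_le_left δ (1 / 2)) hs0.le
  linarith

lemma eventually_le_of_lt_refinedLelong (hφ : IsPlurisubharmonicOn φ (polydisc n))
    (hT : IsToric φ) {x : Fin n → ℝ} (hx : ∀ i, 0 < x i) {a : ℝ}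
    (ha : ENNReal.ofReal a < refinedLelong φ x) :
    ∀ᶠ r : ℝ in atTop, φ (expPoint ((-r) • x)) ≤ ((-(a * r) : ℝ) : EReal) := by
  rcases bot_or_finite hφ hT with hbot | hfin
  · filter_upwards [eventually_gt_atTop 0] with r hr
    rw [hbot _ (neg_smul_neg_of_pos hx hr)]
    exact bot_le
  · obtain ⟨L, hL0, hL⟩ := exists_tendsto_logProfile hφ hT hfin hx
    rw [refinedLelong_of_pos hx, kiselmanInterior_of_tendsto hφ hT hfin hx hL] at ha
    have haL : a < L := ENNReal.ofReal_lt_ofReal_iff'.1 ha |>.1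
    filter_upwards [eventually_gt_atTop 0, hL.eventually (lt_mem_nhds haL)] with r hr h
    rw [lt_div_iff₀ hr] at h
    rw [← coe_logProfile hφ hfin (neg_smul_neg_of_pos hx hr), EReal.coe_le_coe_iff]
    linarith

/-- Integrability of `exp (-2 c f)` on sets of measure at least `κ exp (-2 q r)`, where `f ≤ -a r`,
forces `c a ≤ q`. -/
lemma mul_le_of_lintegral_lt_top {X : Type*} [MeasurableSpace X] {μ : Measure X} {f : X → EReal}
    {U : Set X} {c a q κ : ℝ} (hc : 0 ≤ c) (hκ : 0 < κ)
    (hint : ∫⁻ z in U, EReal.exp (((-2 * c : ℝ) : EReal) * f z) ∂μ < ∞) {B : ℝ → Set X}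
    (hBm : ∀ r, MeasurableSet (B r)) (hBU : ∀ᶠ r in atTop, B r ⊆ U)
    (hf : ∀ᶠ r : ℝ in atTop, ∀ z ∈ B r, f z ≤ ((-(a * r) : ℝ) : EReal))
    (hμ : ∀ᶠ r : ℝ in atTop, ENNReal.ofReal (κ * Real.exp (-2 * r * q)) ≤ μ (B r)) :
    c * a ≤ q := by
  by_contra hcon
  rw [not_le] at hcon
  have hlim : Tendsto (fun r : ℝ => κ * Real.exp (2 * (c * a - q) * r)) atTop atTop :=
    (Real.tendsto_exp_atTop.comp
      (tendsto_id.const_mul_atTop (by linarith : 0 < 2 * (c * a - q)))).const_mul_atTop hκ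
  have hlim2 := ENNReal.tendsto_ofReal_atTop.comp hlim
  obtain ⟨r, hrU, hrf, hrμ, hr⟩ := (hBU.and (hf.and (hμ.and
    (hlim2.eventually (lt_mem_nhds hint))))).exists
  refine absurd hr (not_lt.2 ?_)
  calc ENNReal.ofReal (κ * Real.exp (2 * (c * a - q) * r))
      = ENNReal.ofReal (Real.exp (2 * c * a * r)) * ENNReal.ofReal (κ * Real.exp (-2 * r * q)) := by
        rw [← ENNReal.ofReal_mul (Real.exp_pos _).le, mul_left_comm, ← Real.exp_add]
        congr 3
        ring
    _ ≤ ENNReal.ofReal (Real.exp (2 * c * a * r)) * μ (B r) := by gcongr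
    _ = ∫⁻ _ in B r, ENNReal.ofReal (Real.exp (2 * c * a * r)) ∂μ := by
        rw [setLIntegral_const]
    _ ≤ ∫⁻ z in B r, EReal.exp (((-2 * c : ℝ) : EReal) * f z) ∂μ := by
        refine setLIntegral_mono' (hBm r) fun z hz => ?_
        rw [← EReal.exp_coe]
        refine EReal.exp_monotone ?_
        have h2 := EReal.mul_le_mul_of_nonpos_right (hrf z hz)
          (c := ((-2 * c : ℝ) : EReal)) (EReal.coe_nonpos.2 (by linarith))
        rw [← EReal.coe_mul, mul_comm (f z)] at h2
        refine le_trans (EReal.coe_le_coe_iff.2 (le_of_eq ?_)) h2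
        ring
    _ ≤ _ := lintegral_mono_set hrU

/-- Test sets along a direction `x` bound the exponents of integrability by the quotient at `x`. -/
lemma ofReal_le_gaugeQuotient [NeZero n] (hφ : IsPlurisubharmonicOn φ (polydisc n))
    (hT : IsToric φ) {T : ℝ} (hT0 : 0 < T) {x : Fin n → ℝ} (hx : x ∈ stdSimplex ℝ (Fin n))
    (hx0 : ∀ i, 0 < x i) {X : Type*} [MeasurableSpace X] {μ : Measure X}
    {F : X → Fin n → ℂ} {U : Set X} {c κ : ℝ} (hc : 0 ≤ c) (hκ : 0 < κ)
    (hint : ∫⁻ z in U, EReal.exp (((-2 * c : ℝ) : EReal) * φ (F z)) ∂μ < ∞) {B : ℝ → Set X}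
    (hBm : ∀ r, MeasurableSet (B r)) (hBU : ∀ᶠ r in atTop, B r ⊆ U)
    (hF : ∀ᶠ r : ℝ in atTop, ∀ z ∈ B r, ∀ i, ‖F z i‖ ≤ Real.exp (-(r * x i)))
    (hμ : ∀ᶠ r : ℝ in atTop,
      ENNReal.ofReal (κ * Real.exp (-2 * r * weightGauge n T x)) ≤ μ (B r)) :
    ENNReal.ofReal c ≤ gaugeQuotient φ T x := by
  rcases hc.eq_or_lt with rfl | hc0
  · simp
  rw [gaugeQuotient_of_mem hx]
  refine ENNReal.le_div_iff_mul_le (Or.inr ?_) (Or.inr ENNReal.ofReal_ne_top) |>.2 ?_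
  · simpa using weightGauge_pos hT0 hx
  -- Solved for `ν`, the claim is an upper bound on `refinedLelong φ x`, which may be checked for
  -- each `b` below it; this also covers the value `∞`.
  rw [mul_comm, ← ENNReal.le_div_iff_mul_le (Or.inl (by simpa using hc0))
    (Or.inl ENNReal.ofReal_ne_top), ← ENNReal.ofReal_div_of_pos hc0]
  refine le_of_forall_lt_imp_le_of_dense fun b hb => ?_
  have hbtop : b ≠ ⊤ := ne_top_of_lt hb
  rw [← ENNReal.ofReal_toReal hbtop] at hb ⊢
  refine ENNReal.ofReal_le_ofReal ?_
  rw [le_div_iff₀' hc0]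
  refine mul_le_of_lintegral_lt_top hc hκ hint hBm hBU ?_ hμ
  filter_upwards [eventually_le_of_lt_refinedLelong hφ hT hx0 hb, hF, eventually_gt_atTop 0]
    with r h1 h2 hr z hz
  refine (le_expPoint hφ hT (neg_smul_neg_of_pos hx0 hr) fun i => ?_).trans h1
  simpa using h2 z hz i

end

/-! ### The threshold for the weight `‖z‖ ^ (2t)` -/

section

variable {n : ℕ} {φ : (Fin n → ℂ) → EReal}

/-- By Fubini this reduces to one complex variable, where `|w| ^ (-α)` is locally integrable for `α
< 2`, the real dimension. -/
lemma lintegral_prod_norm_rpow_lt_top {k : ℕ} {α : ℝ} (hα : α < 2) (ρ : ℝ) :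
    ∫⁻ z in {z : Fin k → ℂ | ∀ i, ‖z i‖ < ρ}, ENNReal.ofReal (∏ i, ‖z i‖ ^ (-α)) < ∞ := by
  set g : ℂ → ℝ := (Metric.ball (0 : ℂ) ρ).indicator fun w => ‖w‖ ^ (-α) with hg
  have hmeas : Measurable fun w : ℂ => ‖w‖ ^ (-α) := by fun_prop
  have hgint : Integrable g := by
    rw [hg, integrable_indicator_iff measurableSet_ball]
    refine integrableOn_ball_of_norm_le_rpow (C := 1) (α := α) (by simp) (by simpa using hα) ?_
      hmeas.aestronglyMeasurable
    refine ae_of_all _ fun w => ?_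
    rw [one_mul, Real.norm_of_nonneg (by positivity)]
  have hprod : Integrable (fun z : Fin k → ℂ => ∏ i, g (z i)) := Integrable.fintype_prod fun _ => hgint
  have hset : MeasurableSet {z : Fin k → ℂ | ∀ i, ‖z i‖ < ρ} := by
    simp only [Set.ofPred_forall]
    exact MeasurableSet.iInter fun i => measurableSet_lt (by fun_prop) measurable_const
  refine lt_of_le_of_lt (setLIntegral_mono' hset fun z hz => ?_)
    ((setLIntegral_le_lintegral _ _).trans_lt hprod.lintegral_lt_top)
  refine ENNReal.ofReal_le_ofReal (le_of_eq (Finset.prod_congr rfl fun i _ => ?_))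
  rw [hg, Set.indicator_of_mem (by simpa using hz i)]

/-- The pointwise bound for `exp (-2 c φ)` near the origin, off the coordinate hyperplanes. -/
lemma exists_exp_le [NeZero n] (hφ : IsPlurisubharmonicOn φ (polydisc n))
    (hT : IsToric φ) {T c : ℝ} (hT0 : 0 < T) (hc : 0 < c)
    (h : ∀ x ∈ stdSimplex ℝ (Fin n), ENNReal.ofReal c < gaugeQuotient φ T x) :
    ∃ ρ : ℝ, 0 < ρ ∧ ∃ α : ℝ, 0 < α ∧ α < 2 ∧ ∀ z : Fin n → ℂ, (∀ i, z i ≠ 0) → (∀ i, ‖z i‖ < ρ) →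
      ∃ i₀, EReal.exp (((-2 * c : ℝ) : EReal) * φ z) ≤
        ENNReal.ofReal ((∏ i, ‖z i‖ ^ (-α)) * ‖z i₀‖ ^ (2 * (n - T))) := by
  obtain ⟨R, hR, δ, hδ0, hδ1, H⟩ := exists_uniform_bound hφ hT hT0 hc h
  have hfin := finite_of_lt_gaugeQuotient hφ hT h
  refine ⟨Real.exp (-R), Real.exp_pos _, 2 * (1 - δ), by linarith, by linarith, fun z hz hzρ => ?_⟩
  have hpos : ∀ i, 0 < ‖z i‖ := fun i => norm_pos_iff.2 (hz i)
  set u : Fin n → ℝ := fun i => -Real.log ‖z i‖ with hu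
  have huR : ∀ i, R ≤ u i := fun i => by
    have := (Real.log_lt_iff_lt_exp (hpos i)).2 (hzρ i)
    simp only [hu]
    linarith
  have hexp : ∀ i, Real.exp (-u i) = ‖z i‖ := fun i => by
    simp only [hu, neg_neg, Real.exp_log (hpos i)]
  -- The smallest `u i` belongs to a coordinate of largest modulus; the term `(T - n) * min u` of
  -- the gauge becomes the power `2 * (n - T)` of it.
  obtain ⟨i₀, hi₀⟩ := exists_eq_ciInf_of_finite (f := u)
  have hneg : ∀ i, (-u) i < 0 := fun i => neg_neg_of_pos (hR.trans_le (huR i))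
  refine ⟨i₀, ?_⟩
  rw [hT.apply_eq_expPoint hneg fun i => (hexp i).symm, ← coe_logProfile hφ hfin hneg,
    ← EReal.coe_mul, EReal.exp_coe]
  refine ENNReal.ofReal_le_ofReal ?_
  have hrp : ∀ i (b : ℝ), ‖z i‖ ^ b = Real.exp (-u i * b) := fun i b => by
    rw [← hexp i, ← Real.exp_mul]
  simp only [hrp]
  rw [← Real.exp_sum, ← Real.exp_add, Real.exp_le_exp, ← Finset.sum_mul, Finset.sum_neg_distrib]
  have h1 := H u huR
  rw [weightGauge, ← hi₀] at h1
  linarith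

lemma volume_polydisc_exp {k : ℕ} {b : ℝ} (hb : 0 < b) (r : ℝ) (y : Fin k → ℝ) :
    volume {w : Fin k → ℂ | ∀ j, ‖w j‖ ≤ b * Real.exp (-(r * y j))} =
      ENNReal.ofReal ((b ^ 2 * Real.pi) ^ k * Real.exp (-2 * r * ∑ j, y j)) := by
  have hset : {w : Fin k → ℂ | ∀ j, ‖w j‖ ≤ b * Real.exp (-(r * y j))} =
      Set.univ.pi fun j => Metric.closedBall (0 : ℂ) (b * Real.exp (-(r * y j))) := by
    ext w
    simp
  rw [hset, volume_pi_pi]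
  have h1 : ∀ j, volume (Metric.closedBall (0 : ℂ) (b * Real.exp (-(r * y j)))) =
      ENNReal.ofReal (b ^ 2 * Real.pi * Real.exp (-2 * r * y j)) := fun j => by
    rw [Complex.volume_closedBall, ← ENNReal.ofReal_pow (by positivity), ← NNReal.coe_real_pi,
      mul_right_comm, ENNReal.ofReal_mul (q := (NNReal.pi : ℝ)) (by positivity),
      ENNReal.ofReal_coe_nnreal]
    congr 2
    rw [mul_pow, ← Real.exp_nat_mul]
    congr 2
    push_cast
    ring
  simp only [h1]
  rw [← ENNReal.ofReal_prod_of_nonneg fun _ _ => by positivity, Finset.prod_mul_distrib,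
    ← Real.exp_sum, ← Finset.mul_sum]
  simp

lemma measurableSet_polydisc_exp {k : ℕ} (b r : ℝ) (y : Fin k → ℝ) :
    MeasurableSet {w : Fin k → ℂ | ∀ j, ‖w j‖ ≤ b * Real.exp (-(r * y j))} := by
  simp only [Set.ofPred_forall]
  exact MeasurableSet.iInter fun i => measurableSet_le (by fun_prop) measurable_const

lemma eventually_polydisc_exp_subset {k : ℕ} (b : ℝ) {y : Fin k → ℝ} (hy : ∀ i, 0 < y i)
    {U : Set (Fin k → ℂ)} (hU : U ∈ 𝓝 0) :
    ∀ᶠ r : ℝ in atTop, {w : Fin k → ℂ | ∀ j, ‖w j‖ ≤ b * Real.exp (-(r * y j))} ⊆ U := by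
  obtain ⟨ε, hε, hball⟩ := Metric.mem_nhds_iff.1 hU
  have h : ∀ᶠ r : ℝ in atTop, ∀ j, b * Real.exp (-(r * y j)) < ε := by
    refine eventually_all.2 fun j => ?_
    have h1 : Tendsto (fun r : ℝ => b * Real.exp (-(r * y j))) atTop (𝓝 (b * 0)) :=
      (Real.tendsto_exp_neg_atTop_nhds_zero.comp (tendsto_id.atTop_mul_const (hy j))).const_mul b
    rw [mul_zero] at h1
    exact h1.eventually (gt_mem_nhds hε)
  filter_upwards [h] with r hr w hw
  refine hball ?_
  rw [mem_ball_zero_iff, pi_norm_lt_iff hε]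
  exact fun j => (hw j).trans_lt (hr j)

lemma measurable_normWeight_density (t : ℝ) :
    Measurable fun z : Fin n → ℂ => ENNReal.ofReal (∑ i, ‖z i‖ ^ 2) ^ t := by
  fun_prop

lemma ae_coord_ne_zero : ∀ᵐ z : Fin n → ℂ, ∀ i, z i ≠ 0 := by
  refine ae_all_iff.2 fun i => ?_
  have := Measure.pi_hyperplane (fun _ : Fin n => (volume : Measure ℂ)) i 0
  rw [ae_iff]
  simpa [volume_pi] using this

/-- As `t < 0`, the weight is at most `|z_{i₀}| ^ (2t)`, which cancels exactly the factor `|z_{i₀}|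
^ (2 (n - T))` for `T = t + n`. -/
lemma ofReal_le_weightedLCT_normWeight [NeZero n] (hφ : IsPlurisubharmonicOn φ (polydisc n))
    (hT : IsToric φ) {t c : ℝ} (htn : -(n : ℝ) < t) (ht : t < 0) (hc : 0 < c)
    (h : ∀ x ∈ stdSimplex ℝ (Fin n), ENNReal.ofReal c < gaugeQuotient φ (t + n) x) :
    ENNReal.ofReal c ≤ weightedLCT (normWeight n t) φ := by
  obtain ⟨ρ, hρ, α, -, hα, H⟩ := exists_exp_le hφ hT (by linarith) hc h
  set U : Set (Fin n → ℂ) := {z | ∀ i, ‖z i‖ < ρ} with hU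
  have hUo : IsOpen U := by
    simp only [hU, Set.ofPred_forall]
    exact isOpen_iInter_of_finite fun i => isOpen_lt (by fun_prop) continuous_const
  refine le_sSup ⟨c, hc.le, rfl, U, hUo.mem_nhds (by simpa [hU] using hρ), ?_⟩
  rw [normWeight, restrict_withDensity hUo.measurableSet]
  refine (lintegral_withDensity_le_lintegral_mul _ (measurable_normWeight_density t) _).trans_lt
    (lt_of_le_of_lt (lintegral_mono_ae ?_) (lintegral_prod_norm_rpow_lt_top hα ρ))
  filter_upwards [ae_restrict_mem hUo.measurableSet, ae_restrict_of_ae ae_coord_ne_zero]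
    with z hzU hz
  obtain ⟨i₀, h1⟩ := H z hz hzU
  have hpos : 0 < ‖z i₀‖ := norm_pos_iff.2 (hz i₀)
  have hle : ‖z i₀‖ ^ 2 ≤ ∑ i, ‖z i‖ ^ 2 :=
    Finset.single_le_sum (f := fun i => ‖z i‖ ^ 2) (fun i _ => sq_nonneg _) (Finset.mem_univ i₀)
  have hsum : 0 < ∑ i, ‖z i‖ ^ 2 := lt_of_lt_of_le (by positivity) hle
  have h2 : ENNReal.ofReal (∑ i, ‖z i‖ ^ 2) ^ t ≤ ENNReal.ofReal (‖z i₀‖ ^ (2 * t)) := by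
    rw [ENNReal.ofReal_rpow_of_pos hsum]
    refine ENNReal.ofReal_le_ofReal ((Real.rpow_le_rpow_of_nonpos (by positivity) hle ht.le).trans
      (le_of_eq ?_))
    rw [← Real.rpow_natCast, ← Real.rpow_mul hpos.le]
    norm_num
  refine (mul_le_mul' h2 h1).trans (le_of_eq ?_)
  rw [← ENNReal.ofReal_mul (by positivity), mul_left_comm, ← Real.rpow_add hpos]
  congr 1
  have : 2 * t + 2 * ((n : ℝ) - (t + n)) = 0 := by ring
  rw [this, Real.rpow_zero, mul_one]

/-- On the test polydisc `∑ |zᵢ|² ≤ n * exp (-2 r min x)`, so the weight is at least `n ^ t * exp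
(-2 r t min x)`. Times the volume this is a constant times `exp (-2 r ψ x)`. -/
lemma weightedLCT_normWeight_le [NeZero n] (hφ : IsPlurisubharmonicOn φ (polydisc n))
    (hT : IsToric φ) {t : ℝ} (htn : -(n : ℝ) < t) (ht : t < 0) {x : Fin n → ℝ}
    (hx : x ∈ stdSimplex ℝ (Fin n)) (hx0 : ∀ i, 0 < x i) :
    weightedLCT (normWeight n t) φ ≤ gaugeQuotient φ (t + n) x := by
  have hn : (0 : ℝ) < n := Nat.cast_pos.2 (NeZero.pos n)
  refine sSup_le ?_
  rintro _ ⟨c, hc, rfl, U, hU, hint⟩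
  refine ofReal_le_gaugeQuotient hφ hT (by linarith) hx hx0 (F := id) (U := U) hc
    (κ := (n : ℝ) ^ t * (1 ^ 2 * Real.pi) ^ n) (by positivity) hint
    (fun r => measurableSet_polydisc_exp 1 r x) (eventually_polydisc_exp_subset 1 hx0 hU)
    (Eventually.of_forall fun r z hz i => by simpa using hz i) ?_
  filter_upwards [eventually_ge_atTop 0] with r hr
  set B : Set (Fin n → ℂ) := {w | ∀ j, ‖w j‖ ≤ 1 * Real.exp (-(r * x j))} with hB
  have hBm : MeasurableSet B := measurableSet_polydisc_exp 1 r x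
  set m := ⨅ i, x i with hm
  rw [normWeight, withDensity_apply _ hBm]
  have hlow : ∀ z ∈ B, ENNReal.ofReal ((n * Real.exp (-2 * r * m)) ^ t) ≤
      ENNReal.ofReal (∑ i, ‖z i‖ ^ 2) ^ t := by
    intro z hz
    have hle : ∑ i, ‖z i‖ ^ 2 ≤ n * Real.exp (-2 * r * m) := by
      have h1 : ∀ i ∈ Finset.univ, ‖z i‖ ^ 2 ≤ Real.exp (-2 * r * m) := fun i _ => by
        have h2 := hz i
        rw [one_mul] at h2
        refine (pow_le_pow_left₀ (norm_nonneg _) h2 2).trans ?_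
        rw [← Real.exp_nat_mul, Real.exp_le_exp]
        have := mul_le_mul_of_nonneg_left (iInf_le_apply x i) hr
        push_cast
        linarith
      simpa using Finset.sum_le_card_nsmul _ _ _ h1
    rw [← ENNReal.ofReal_rpow_of_pos (by positivity)]
    rw [← neg_neg t, ENNReal.rpow_neg, ENNReal.rpow_neg _ (-t), ENNReal.inv_le_inv]
    exact ENNReal.rpow_le_rpow (ENNReal.ofReal_le_ofReal hle) (neg_nonneg.2 ht.le)
  refine le_trans (le_of_eq ?_) (setLIntegral_mono' hBm hlow)
  rw [setLIntegral_const, hB, volume_polydisc_exp one_pos, ← ENNReal.ofReal_mul (by positivity)]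
  congr 1
  rw [Real.mul_rpow hn.le (Real.exp_pos _).le, ← Real.exp_mul, weightGauge, ← hm]
  have : Real.exp (-2 * r * (∑ i, x i + (t + n - n) * m)) =
      Real.exp (-2 * r * m * t) * Real.exp (-2 * r * ∑ i, x i) := by
    rw [← Real.exp_add]
    congr 1
    ring
  rw [this]
  ring

end

/-! ### Upper bound for restrictions to arbitrary subspaces -/

section

variable {n k : ℕ} {φ : (Fin n → ℂ) → EReal}

/-- A square complex matrix with nonzero determinant as a linear homeomorphism. -/
noncomputable def matrixEquiv (M : Matrix (Fin k) (Fin k) ℂ) (hM : M.det ≠ 0) :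
    (Fin k → ℂ) ≃L[ℂ] (Fin k → ℂ) :=
  (LinearEquiv.ofBijective M.mulVecLin (by
    have hinj : Function.Injective M.mulVecLin :=
      Matrix.mulVec_injective_of_isUnit ((Matrix.isUnit_iff_isUnit_det M).2 hM.isUnit)
    exact ⟨hinj, LinearMap.injective_iff_surjective.1 hinj⟩)).toContinuousLinearEquiv

lemma exists_map_volume_eq_smul (e : (Fin k → ℂ) ≃L[ℂ] (Fin k → ℂ)) :
    ∃ a : ℝ, 0 < a ∧ Measure.map e volume = ENNReal.ofReal a • (volume : Measure (Fin k → ℂ)) := by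
  refine ⟨Measure.addHaarScalarFactor (Measure.map e volume) volume,
    Measure.addHaarScalarFactor_pos_of_isAddHaarMeasure _ _, ?_⟩
  rw [ENNReal.ofReal_coe_nnreal]
  exact Measure.isAddLeftInvariant_eq_smul _ _

lemma exists_submatrix_det_ne_zero {A : Matrix (Fin n) (Fin k) ℂ}
    (hA : Function.Injective A.mulVec) : ∃ e : Fin k → Fin n, (A.submatrix e id).det ≠ 0 := by
  have hrank : Module.finrank ℂ (Submodule.span ℂ (Set.range A.row)) = k := by
    rw [← Matrix.rank_eq_finrank_span_row, Matrix.rank, LinearMap.finrank_range_of_inj hA]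
    simp
  obtain ⟨f, hf, -, hind⟩ := Submodule.exists_fun_fin_finrank_span_eq ℂ (Set.range A.row)
  choose g hg using hf
  refine ⟨fun i => g (Fin.cast hrank.symm i), ?_⟩
  have h2 : LinearIndependent ℂ (A.submatrix (fun i => g (Fin.cast hrank.symm i)) id).row := by
    have h1 : (A.submatrix (fun i => g (Fin.cast hrank.symm i)) id).row =
        f ∘ Fin.cast hrank.symm := funext fun i => hg _
    rw [h1]
    exact hind.comp (Fin.cast hrank.symm) (Fin.cast_injective _)
  exact ((Matrix.isUnit_iff_isUnit_det _).1 (Matrix.linearIndependent_rows_iff_isUnit.1 h2)).ne_zero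

/-- Rows of an injective matrix with maximal total weight express every other row through rows of
at least the same weight. -/
lemma exists_dominating_rows {A : Matrix (Fin n) (Fin k) ℂ} (hA : Function.Injective A.mulVec)
    (x : Fin n → ℝ) :
    ∃ e : Fin k → Fin n, (A.submatrix e id).det ≠ 0 ∧ ∃ d : Fin n → Fin k → ℂ,
      (∀ i j, d i j ≠ 0 → x i ≤ x (e j)) ∧
      ∀ w i, A.mulVec w i = ∑ j, d i j * A.mulVec w (e j) := by
  classical
  obtain ⟨e₀, he₀⟩ := exists_submatrix_det_ne_zero hA
  obtain ⟨e, he, hmax⟩ := Finset.exists_max_image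
    (Finset.univ.filter fun e : Fin k → Fin n => (A.submatrix e id).det ≠ 0)
    (fun e => ∑ j, x (e j)) ⟨e₀, by simpa using he₀⟩
  simp only [Finset.mem_filter, Finset.mem_univ, true_and] at he hmax
  set M := A.submatrix e id with hM
  -- Cramer's rule gives the coefficients. A nonzero one means that exchanging row `e j` for row `i`
  -- keeps the minor nonzero, so maximality of the total weight gives `x i ≤ x (e j)`.
  refine ⟨e, he, fun i j => M.det⁻¹ * (M.updateRow j (A i)).det, fun i j hij => ?_, fun w i => ?_⟩
  · have h1 : M.updateRow j (A i) = A.submatrix (Function.update e j i) id := by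
      ext a b
      rcases eq_or_ne a j with rfl | h
      · simp
      · simp [h, hM]
    have h2 := hmax (Function.update e j i) (by
      rw [← h1]
      exact (mul_ne_zero_iff.1 hij).2)
    have h3 : ∀ f : Fin k → Fin n, ∑ a, x (f a) = x (f j) + ∑ a ∈ Finset.univ.erase j, x (f a) :=
      fun f => (Finset.add_sum_erase _ (fun a => x (f a)) (Finset.mem_univ j)).symm
    rw [h3, h3 e, Function.update_self, Finset.sum_congr rfl fun a ha => by
      rw [Function.update_of_ne (Finset.ne_of_mem_erase ha)]] at h2
    linarith
  · have h1 := Matrix.mulVec_cramer M.transpose (A i)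
    rw [Matrix.det_transpose] at h1
    have h2 : M.det * A.mulVec w i = ∑ j, (M.updateRow j (A i)).det * A.mulVec w (e j) := by
      have h3 := congrArg (fun v => v ⬝ᵥ w) h1
      simp only [smul_dotProduct, smul_eq_mul] at h3
      have h4 : A.mulVec w i = A i ⬝ᵥ w := rfl
      rw [h4, ← h3, Matrix.mulVec_transpose, ← Matrix.dotProduct_mulVec]
      simp only [dotProduct, Matrix.cramer_transpose_apply]
      rfl
    rw [← mul_right_inj' he, h2, Finset.mul_sum]
    refine Finset.sum_congr rfl fun j _ => ?_
    field_simp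

/-- The `n - k` coordinates outside the image of `e` are each at least the minimum. -/
lemma sum_comp_le_weightGauge {x : Fin n → ℝ} {e : Fin k → Fin n}
    (he : Function.Injective e) : ∑ j, x (e j) ≤ weightGauge n k x := by
  classical
  set s := Finset.univ.image e with hs
  have hcard : s.card = k := by
    rw [hs, Finset.card_image_of_injective _ he, Finset.card_univ, Fintype.card_fin]
  have h1 : ∑ i ∈ s, x i = ∑ j, x (e j) := Finset.sum_image he.injOn
  have h2 : ∑ i ∈ s, x i + ∑ i ∈ sᶜ, x i = ∑ i, x i := Finset.sum_add_sum_compl s x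
  have h3 := Finset.card_nsmul_le_sum sᶜ x (⨅ i, x i) fun i _ => iInf_le_apply x i
  have hkn : k ≤ n := by simpa using Fintype.card_le_of_injective e he
  rw [Finset.card_compl, hcard, Fintype.card_fin, nsmul_eq_mul, Nat.cast_sub hkn] at h3
  rw [weightGauge]
  linarith

/-- In the coordinates given by the dominating rows the test set is a polydisc. Every other row
involves only rows of at least its own weight, so its entry is also of size at most `exp (-r x i)`.
-/
lemma weightedLCT_comp_le [NeZero n] (hφ : IsPlurisubharmonicOn φ (polydisc n))
    (hT : IsToric φ) (hk : 1 ≤ k) {L : (Fin k → ℂ) →ₗ[ℂ] (Fin n → ℂ)} (hL : Function.Injective L)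
    {x : Fin n → ℝ} (hx : x ∈ stdSimplex ℝ (Fin n)) (hx0 : ∀ i, 0 < x i) :
    weightedLCT (volume : Measure (Fin k → ℂ)) (fun w => φ (L w)) ≤ gaugeQuotient φ k x := by
  set A := LinearMap.toMatrix' L with hA
  have hAL : ∀ w, A.mulVec w = L w := fun w => LinearMap.toMatrix'_mulVec L w
  have hAinj : Function.Injective A.mulVec := by
    have : A.mulVec = L := funext hAL
    rw [this]
    exact hL
  obtain ⟨e, he, d, hd, hrow⟩ := exists_dominating_rows hAinj x
  have heinj : Function.Injective e := fun a b hab => by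
    by_contra hne
    refine he (Matrix.det_zero_of_row_eq hne ?_)
    ext j
    simp [hab]
  set M := matrixEquiv _ he with hM
  have hMe : ∀ w j, M w j = L w (e j) := fun w j => by
    rw [← hAL]
    rfl
  obtain ⟨a, ha, hmap⟩ := exists_map_volume_eq_smul M
  set D := ∑ i, ∑ j, ‖d i j‖ with hD
  have hD0 : 0 ≤ D := Finset.sum_nonneg fun i _ => Finset.sum_nonneg fun j _ => norm_nonneg _
  -- Shrinking the radii by `b` absorbs the coefficients `d i j`, since `D * b ≤ 1`.
  set b := (D + 1)⁻¹ with hb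
  have hb0 : 0 < b := by positivity
  have hDb : D * b ≤ 1 := by
    rw [hb, ← div_eq_mul_inv, div_le_one (by positivity)]
    linarith
  set y : Fin k → ℝ := fun j => x (e j) with hy
  refine sSup_le ?_
  rintro _ ⟨c, hc, rfl, U, hU, hint⟩
  refine ofReal_le_gaugeQuotient hφ hT (T := k) (by exact_mod_cast hk) hx hx0 (F := fun w => L w)
    (U := U) hc (κ := a * (b ^ 2 * Real.pi) ^ k) (by positivity) hint
    (B := fun r => M ⁻¹' {w : Fin k → ℂ | ∀ j, ‖w j‖ ≤ b * Real.exp (-(r * y j))})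
    (fun r => M.continuous.measurable (measurableSet_polydisc_exp b r y)) ?_ ?_ ?_
  · have hU' : M.symm ⁻¹' U ∈ 𝓝 (0 : Fin k → ℂ) := by
      refine M.symm.continuous.continuousAt.preimage_mem_nhds ?_
      rwa [map_zero]
    filter_upwards [eventually_polydisc_exp_subset b (y := y) (fun j => hx0 _) hU'] with r hr w hw
    have := hr hw
    simpa using this
  · filter_upwards [eventually_ge_atTop 0] with r hr w hw i
    rw [← hAL, hrow]
    simp only [hAL]
    calc ‖∑ j, d i j * L w (e j)‖ ≤ ∑ j, ‖d i j‖ * (b * Real.exp (-(r * x i))) := by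
          refine norm_sum_le_of_le _ fun j _ => ?_
          rw [norm_mul]
          rcases eq_or_ne (d i j) 0 with h0 | h0
          · simp [h0]
          · refine mul_le_mul_of_nonneg_left ?_ (norm_nonneg _)
            have h1 := hw j
            rw [hMe] at h1
            refine h1.trans (mul_le_mul_of_nonneg_left (Real.exp_le_exp.2 ?_) hb0.le)
            exact neg_le_neg (mul_le_mul_of_nonneg_left (hd i j h0) hr)
      _ = (∑ j, ‖d i j‖) * b * Real.exp (-(r * x i)) := by rw [← Finset.sum_mul, mul_assoc]
      _ ≤ D * b * Real.exp (-(r * x i)) := by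
          gcongr
          exact Finset.single_le_sum (f := fun i => ∑ j, ‖d i j‖)
            (fun i _ => Finset.sum_nonneg fun j _ => norm_nonneg _) (Finset.mem_univ i)
      _ ≤ 1 * Real.exp (-(r * x i)) := by gcongr
      _ = _ := one_mul _
  · filter_upwards [eventually_ge_atTop 0] with r hr
    rw [← Measure.map_apply M.continuous.measurable (measurableSet_polydisc_exp b r y), hmap,
      Measure.smul_apply, volume_polydisc_exp hb0, smul_eq_mul, ← ENNReal.ofReal_mul ha.le]
    refine ENNReal.ofReal_le_ofReal ?_
    rw [mul_assoc]
    refine mul_le_mul_of_nonneg_left (mul_le_mul_of_nonneg_left (Real.exp_le_exp.2 ?_)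
      (by positivity)) ha.le
    have := mul_le_mul_of_nonneg_left (sum_comp_le_weightGauge (x := x) heinj) hr
    simp only [hy]
    linarith

end

/-! ### Lower bound: a generic subspace -/

section

variable {n k : ℕ} {φ : (Fin n → ℂ) → EReal}

/-- The Vandermonde matrix with nodes `0, …, n - 1` and `k` columns; its maximal minors do not
vanish. -/
noncomputable def rectVandermonde (n k : ℕ) : Matrix (Fin n) (Fin k) ℂ :=
  Matrix.of fun i j => ((i : ℕ) : ℂ) ^ (j : ℕ)

lemma det_rectVandermonde_ne_zero {e : Fin k → Fin n} (he : Function.Injective e) :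
    ((rectVandermonde n k).submatrix e id).det ≠ 0 := by
  have h : (rectVandermonde n k).submatrix e id = Matrix.vandermonde fun j => ((e j : ℕ) : ℂ) := by
    ext i j
    simp [rectVandermonde, Matrix.vandermonde_apply]
  rw [h, Matrix.det_vandermonde_ne_zero_iff]
  intro a b hab
  exact he (Fin.ext (Nat.cast_injective hab))

lemma rectVandermonde_mulVec_injective (hkn : k ≤ n) :
    Function.Injective (rectVandermonde n k).mulVec := by
  intro v w hvw
  have hdet := det_rectVandermonde_ne_zero (Fin.castLE_injective hkn)
  refine (matrixEquiv _ hdet).injective ?_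
  ext j
  exact congrFun hvw (Fin.castLE hkn j)

lemma ae_rectVandermonde_ne_zero (hk : 1 ≤ k) :
    ∀ᵐ w : Fin k → ℂ, ∀ i : Fin n, (rectVandermonde n k).mulVec w i ≠ 0 := by
  refine ae_all_iff.2 fun i => ?_
  set f : (Fin k → ℂ) →ₗ[ℂ] ℂ := LinearMap.proj i ∘ₗ (rectVandermonde n k).mulVecLin with hf
  have hne : (LinearMap.ker f).restrictScalars ℝ ≠ ⊤ := by
    intro htop
    -- The first column of the matrix consists of ones, including the entry `0 ^ 0 = 1` of the node
    -- `0`, so no row vanishes.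
    have h1 : Pi.single (⟨0, hk⟩ : Fin k) (1 : ℂ) ∈ (LinearMap.ker f).restrictScalars ℝ := by
      rw [htop]
      trivial
    simp [hf, rectVandermonde] at h1
  have := Measure.addHaar_submodule volume _ hne
  rw [ae_iff]
  convert this using 2
  ext w
  simp [hf]

/-- Any `k` distinct rows form an invertible matrix, so any `k` coordinates of the image control
`w`. There are finitely many choices of rows, and the sum of their constants serves for all. -/
lemma exists_rectVandermonde_norm_bound (n k : ℕ) :
    ∃ C : ℝ, 1 ≤ C ∧ (∀ w : Fin k → ℂ, ‖(rectVandermonde n k).mulVec w‖ ≤ C * ‖w‖) ∧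
      ∀ e : Fin k → Fin n, Function.Injective e → ∀ (w : Fin k → ℂ) (s : ℝ), 0 ≤ s →
        (∀ j, ‖(rectVandermonde n k).mulVec w (e j)‖ ≤ s) → ‖w‖ ≤ C * s := by
  set A := rectVandermonde n k with hA
  set N : (Fin k → ℂ) →L[ℂ] (Fin n → ℂ) := LinearMap.toContinuousLinearMap A.mulVecLin with hN
  have hexists : ∀ e : Fin k → Fin n, ∃ C : ℝ, 0 ≤ C ∧ (Function.Injective e →
      ∀ (w : Fin k → ℂ) (s : ℝ), 0 ≤ s → (∀ j, ‖A.mulVec w (e j)‖ ≤ s) → ‖w‖ ≤ C * s) := by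
    intro e
    by_cases he : Function.Injective e
    · set M := matrixEquiv _ (det_rectVandermonde_ne_zero he) with hM
      refine ⟨‖(M.symm : (Fin k → ℂ) →L[ℂ] (Fin k → ℂ))‖, norm_nonneg _, fun _ w s hs hw => ?_⟩
      have h1 := (M.symm : (Fin k → ℂ) →L[ℂ] (Fin k → ℂ)).le_opNorm (M w)
      have h2 : ‖M w‖ ≤ s := (pi_norm_le_iff_of_nonneg hs).2 hw
      simp only [ContinuousLinearEquiv.coe_coe, ContinuousLinearEquiv.symm_apply_apply] at h1
      exact h1.trans (mul_le_mul_of_nonneg_left h2 (norm_nonneg _))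
    · exact ⟨0, le_rfl, fun h => absurd h he⟩
  choose C hC0 hC using hexists
  have hsum : 0 ≤ ∑ e, C e := Finset.sum_nonneg fun e _ => hC0 e
  refine ⟨1 + ‖N‖ + ∑ e, C e, by linarith [norm_nonneg N], fun w => ?_, fun e he w s hs hw => ?_⟩
  · refine (N.le_opNorm w).trans (mul_le_mul_of_nonneg_right ?_ (norm_nonneg _))
    linarith
  · refine (hC e he w s hs hw).trans (mul_le_mul_of_nonneg_right ?_ hs)
    have := Finset.single_le_sum (f := C) (fun e _ => hC0 e) (Finset.mem_univ e)
    linarith [norm_nonneg N]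

/-- The singular factors at a point of a generic subspace come from at most `k` coordinates. -/
lemma exists_prod_le (hkn : k ≤ n) {α : ℝ} (hα0 : 0 < α) (hα2 : α < 2) :
    ∃ K : ℝ, 0 ≤ K ∧ ∀ w : Fin k → ℂ, ‖w‖ < 1 → (∀ i, (rectVandermonde n k).mulVec w i ≠ 0) →
      ∀ i₀, ∃ e : Fin k → Fin n, Function.Injective e ∧
        (∏ i, ‖(rectVandermonde n k).mulVec w i‖ ^ (-α)) *
            ‖(rectVandermonde n k).mulVec w i₀‖ ^ (2 * ((n : ℝ) - k)) ≤
          K * ∏ j, ‖(rectVandermonde n k).mulVec w (e j)‖ ^ (-α) := by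
  classical
  obtain ⟨C, hC1, hCle, hCge⟩ := exists_rectVandermonde_norm_bound n k
  set A := rectVandermonde n k with hA
  have hC0 : 0 < C := by linarith
  have hnk : (0 : ℝ) ≤ (n : ℝ) - k := sub_nonneg.2 (Nat.cast_le.2 hkn)
  refine ⟨((2 * C) ^ α) ^ ((n : ℝ) - k) * C ^ (2 * ((n : ℝ) - k)), by positivity,
    fun w hw1 hw0 i₀ => ?_⟩
  have hpos : ∀ i, 0 < ‖A.mulVec w i‖ := fun i => norm_pos_iff.2 (hw0 i)
  have hwpos : 0 < ‖w‖ := by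
    refine norm_pos_iff.2 fun h => hw0 i₀ ?_
    rw [h, Matrix.mulVec_zero, Pi.zero_apply]
  -- With this threshold, `k` coordinates of modulus at most `t` would give `‖w‖ ≤ C * t = ‖w‖ / 2`.
  set t := ‖w‖ / (2 * C) with ht
  have ht0 : 0 < t := by positivity
  set S : Finset (Fin n) := Finset.univ.filter fun i => ‖A.mulVec w i‖ ≤ t with hS
  have hScard : S.card ≤ k := by
    by_contra hcon
    obtain ⟨S', hS', hcard⟩ := Finset.exists_subset_card_eq (not_le.1 hcon).le
    have h1 := hCge (S'.orderEmbOfFin hcard) (S'.orderEmbOfFin hcard).injective w t ht0.le fun j =>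
      (Finset.mem_filter.1 (hS' (S'.orderEmbOfFin_mem hcard j))).2
    have h2 : C * t = ‖w‖ / 2 := by
      rw [ht]
      field_simp
    linarith
  obtain ⟨S', hSS', hcard⟩ := Finset.exists_superset_card_eq hScard (by simpa using hkn)
  set e := S'.orderEmbOfFin hcard with he
  refine ⟨e, e.injective, ?_⟩
  have hprod : ∏ i ∈ S', ‖A.mulVec w i‖ ^ (-α) = ∏ j, ‖A.mulVec w (e j)‖ ^ (-α) :=
    (Finset.prod_congr (Finset.image_orderEmbOfFin_univ S' hcard).symm fun _ _ => rfl).trans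
      (Finset.prod_image e.injective.injOn)
  have hcompl : ∏ i ∈ S'ᶜ, ‖A.mulVec w i‖ ^ (-α) ≤ (t ^ (-α)) ^ ((n : ℝ) - k) := by
    have h1 : ∀ i ∈ S'ᶜ, ‖A.mulVec w i‖ ^ (-α) ≤ t ^ (-α) := fun i hi => by
      refine Real.rpow_le_rpow_of_nonpos ht0 ?_ (by linarith)
      by_contra hcon
      exact Finset.mem_compl.1 hi (hSS' (by simpa [hS] using (not_le.1 hcon).le))
    refine (Finset.prod_le_prod (fun i _ => by positivity) h1).trans (le_of_eq ?_)
    rw [Finset.prod_const, Finset.card_compl, hcard, Fintype.card_fin, ← Real.rpow_natCast,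
      Nat.cast_sub hkn]
  rw [← Finset.prod_mul_prod_compl S', hprod, mul_assoc, mul_comm]
  refine mul_le_mul_of_nonneg_right ?_ (Finset.prod_nonneg fun j _ => by positivity)
  have hi₀ : ‖A.mulVec w i₀‖ ^ (2 * ((n : ℝ) - k)) ≤ (C * ‖w‖) ^ (2 * ((n : ℝ) - k)) :=
    Real.rpow_le_rpow (norm_nonneg _) ((norm_le_pi_norm _ i₀).trans (hCle w)) (by positivity)
  refine (mul_le_mul hcompl hi₀ (by positivity) (by positivity)).trans ?_
  have h3 : (t ^ (-α)) ^ ((n : ℝ) - k) =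
      ((2 * C) ^ α) ^ ((n : ℝ) - k) * ‖w‖ ^ (-α * ((n : ℝ) - k)) := by
    rw [ht, div_eq_mul_inv, Real.mul_rpow hwpos.le (by positivity), Real.inv_rpow (by positivity),
      Real.rpow_neg (by positivity : (0 : ℝ) ≤ 2 * C), inv_inv,
      Real.mul_rpow (by positivity) (by positivity), ← Real.rpow_mul hwpos.le, mul_comm]
  rw [h3, Real.mul_rpow hC0.le hwpos.le]
  -- The powers of `‖w‖` combine to `‖w‖ ^ ((2 - α) * (n - k))`, which is at most `1`.
  calc _ = ((2 * C) ^ α) ^ ((n : ℝ) - k) * C ^ (2 * ((n : ℝ) - k)) *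
        (‖w‖ ^ (-α * ((n : ℝ) - k)) * ‖w‖ ^ (2 * ((n : ℝ) - k))) := by ring
    _ ≤ ((2 * C) ^ α) ^ ((n : ℝ) - k) * C ^ (2 * ((n : ℝ) - k)) * 1 := by
        refine mul_le_mul_of_nonneg_left ?_ (by positivity)
        rw [← Real.rpow_add hwpos]
        refine Real.rpow_le_one hwpos.le hw1.le ?_
        have := mul_nonneg (by linarith : 0 ≤ 2 - α) hnk
        linarith
    _ = _ := mul_one _

lemma lintegral_prod_rows_lt_top {α : ℝ} (hα : α < 2) (ρ : ℝ) {e : Fin k → Fin n}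
    (he : Function.Injective e) {V : Set (Fin k → ℂ)}
    (hV : ∀ w ∈ V, ∀ i, ‖(rectVandermonde n k).mulVec w i‖ < ρ) :
    ∫⁻ w in V, ENNReal.ofReal (∏ j, ‖(rectVandermonde n k).mulVec w (e j)‖ ^ (-α)) < ∞ := by
  set M := matrixEquiv _ (det_rectVandermonde_ne_zero he) with hM
  obtain ⟨a, ha, hmap⟩ := exists_map_volume_eq_smul M
  set S : Set (Fin k → ℂ) := {z | ∀ i, ‖z i‖ < ρ} with hS
  have hSm : MeasurableSet S := by
    simp only [hS, Set.ofPred_forall]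
    exact MeasurableSet.iInter fun i => measurableSet_lt (by fun_prop) measurable_const
  have hVS : V ⊆ M ⁻¹' S := fun w hw j => hV w hw (e j)
  have hmeas : Measurable fun z : Fin k → ℂ => ENNReal.ofReal (∏ i, ‖z i‖ ^ (-α)) := by fun_prop
  have h1 := setLIntegral_map (μ := volume) hSm hmeas M.continuous.measurable
  rw [hmap, Measure.restrict_smul, lintegral_smul_measure] at h1
  refine (lintegral_mono_set hVS).trans_lt ?_
  refine lt_of_eq_of_lt h1.symm ?_
  exact ENNReal.mul_lt_top ENNReal.ofReal_lt_top (lintegral_prod_norm_rpow_lt_top hα ρ)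

/-- One Vandermonde subspace serves every `φ` and `c`. The rows that carry the singularity depend on
the point, so the integrand is bounded by a sum over all injective choices, each integrable after a
linear change of variables. -/
lemma ofReal_le_restrictedLCT [NeZero n] (hφ : IsPlurisubharmonicOn φ (polydisc n))
    (hT : IsToric φ) (hk : 1 ≤ k) (hkn : k ≤ n) {c : ℝ} (hc : 0 < c)
    (h : ∀ x ∈ stdSimplex ℝ (Fin n), ENNReal.ofReal c < gaugeQuotient φ k x) :
    ENNReal.ofReal c ≤ restrictedLCT k φ := by
  classical
  obtain ⟨ρ, hρ, α, hα0, hα, H⟩ := exists_exp_le hφ hT (by exact_mod_cast hk) hc h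
  obtain ⟨K, hK0, hK⟩ := exists_prod_le hkn hα0 hα
  set A := rectVandermonde n k with hA
  set V : Set (Fin k → ℂ) := {w | ∀ i, ‖A.mulVec w i‖ < ρ} ∩ Metric.ball 0 1 with hV
  have hVo : IsOpen V := by
    refine IsOpen.inter ?_ Metric.isOpen_ball
    simp only [Set.ofPred_forall]
    exact isOpen_iInter_of_finite fun i => isOpen_lt
      (((continuous_apply i).comp (Continuous.matrix_mulVec continuous_const continuous_id)).norm)
      continuous_const
  have hV0 : (0 : Fin k → ℂ) ∈ V := by simp [hV, hρ]
  refine le_trans ?_ (le_iSup₂ (f := fun (L : (Fin k → ℂ) →ₗ[ℂ] (Fin n → ℂ))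
    (_ : Function.Injective L) => weightedLCT (volume : Measure (Fin k → ℂ)) (fun w => φ (L w)))
    A.mulVecLin (rectVandermonde_mulVec_injective hkn))
  refine le_sSup ⟨c, hc.le, rfl, V, hVo.mem_nhds hV0, ?_⟩
  set F : (Fin k → Fin n) → (Fin k → ℂ) → ℝ≥0∞ := fun e w =>
    ENNReal.ofReal (∏ j, ‖A.mulVec w (e j)‖ ^ (-α)) with hF
  set I : Finset (Fin k → Fin n) := Finset.univ.filter Function.Injective with hI
  have hFm : ∀ e, Measurable (F e) := fun e => by
    have : ∀ i, Measurable fun w : Fin k → ℂ => A.mulVec w i := fun i =>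
      ((continuous_apply i).comp
        (Continuous.matrix_mulVec continuous_const continuous_id)).measurable
    have h2 : ∀ j, Measurable fun w : Fin k → ℂ => ‖A.mulVec w (e j)‖ ^ (-α) := fun j =>
      (this (e j)).norm.pow_const _
    exact (Finset.measurable_prod _ fun j _ => h2 j).ennreal_ofReal
  have hbound : ∫⁻ w in V, EReal.exp (((-2 * c : ℝ) : EReal) * φ (A.mulVecLin w)) ≤
      ∫⁻ w in V, ENNReal.ofReal K * ∑ e ∈ I, F e w := by
    refine lintegral_mono_ae ?_
    filter_upwards [ae_restrict_mem hVo.measurableSet,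
      ae_restrict_of_ae (ae_rectVandermonde_ne_zero (n := n) hk)] with w hwV hw0
    obtain ⟨i₀, h1⟩ := H (A.mulVec w) hw0 hwV.1
    obtain ⟨e, he, h2⟩ := hK w (by simpa using hwV.2) hw0 i₀
    refine h1.trans ((ENNReal.ofReal_le_ofReal h2).trans ?_)
    rw [ENNReal.ofReal_mul hK0]
    refine mul_le_mul_right ?_ _
    exact Finset.single_le_sum (f := fun e => F e w) (fun _ _ => zero_le)
      (by simpa [hI] using he)
  refine hbound.trans_lt ?_
  rw [lintegral_const_mul _ (Finset.measurable_sum _ fun e _ => hFm e),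
    lintegral_finsetSum _ fun e _ => hFm e]
  refine ENNReal.mul_lt_top ENNReal.ofReal_lt_top (ENNReal.sum_lt_top.2 fun e he => ?_)
  exact lintegral_prod_rows_lt_top hα ρ (Finset.mem_filter.1 he).2 fun w hw => hw.1

lemma restrictedLCT_le [NeZero n] (hφ : IsPlurisubharmonicOn φ (polydisc n))
    (hT : IsToric φ) (hk : 1 ≤ k) {x : Fin n → ℝ} (hx : x ∈ stdSimplex ℝ (Fin n))
    (hx0 : ∀ i, 0 < x i) : restrictedLCT k φ ≤ gaugeQuotient φ k x :=
  iSup₂_le fun _ hL => weightedLCT_comp_le hφ hT hk hL hx hx0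

end

end ToricPSH

/-! ### The main theorem -/

open ToricPSH in
theorem mainTheorem3 (n : ℕ) (φ : (Fin n → ℂ) → EReal)
    (hφ : ToricPSH.IsPlurisubharmonicOn φ (ToricPSH.polydisc n)) (hT : ToricPSH.IsToric φ) :
    -- the refined Lelong number is a limit, with a continuous extension to the closed orthant
    ((∀ x : Fin n → ℝ, (∀ i, 0 < x i) →
        Tendsto (ToricPSH.kiselmanQuotient φ x) atBot
          (𝓝 ((ToricPSH.refinedLelong φ x : ℝ≥0∞) : EReal))) ∧
      ContinuousOn (ToricPSH.refinedLelong φ) {x : Fin n → ℝ | ∀ i, 0 ≤ x i}) ∧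
    -- the two formulas for the weighted threshold
    (∀ t : ℝ, -(n : ℝ) < t → t < 0 →
      IsLeast ((fun x : Fin n → ℝ =>
          ENNReal.ofReal (1 + t * ⨅ i, x i) / ToricPSH.refinedLelong φ x) '' stdSimplex ℝ (Fin n))
        (ToricPSH.weightedLCT (ToricPSH.normWeight n t) φ) ∧
      IsGreatest ((fun x : Fin n → ℝ =>
          ToricPSH.dualLelong φ x * ENNReal.ofReal (min (t + n) (1 / ⨆ i, x i))) ''
            stdSimplex ℝ (Fin n))
        (ToricPSH.weightedLCT (ToricPSH.normWeight n t) φ)) ∧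
    -- the two formulas for the thresholds of restrictions to subspaces
    (∀ k : ℕ, 1 ≤ k → k ≤ n →
      IsLeast ((fun x : Fin n → ℝ =>
          ENNReal.ofReal (1 + ((k : ℝ) - n) * ⨅ i, x i) / ToricPSH.refinedLelong φ x) ''
            stdSimplex ℝ (Fin n))
        (ToricPSH.restrictedLCT k φ) ∧
      IsGreatest ((fun x : Fin n → ℝ =>
          ToricPSH.dualLelong φ x * ENNReal.ofReal (min (k : ℝ) (1 / ⨆ i, x i))) ''
            stdSimplex ℝ (Fin n))
        (ToricPSH.restrictedLCT k φ)) := by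
  refine ⟨⟨fun x hx => ?_, refinedLelong_continuousOn hφ hT⟩, fun t htn ht => ?_, fun k hk hkn => ?_⟩
  · rw [refinedLelong_of_pos hx]
    exact tendsto_kiselmanQuotient hφ hT hx
  -- The range `-n < t < 0` is empty for `n = 0`.
  · have hn : NeZero n := ⟨by
      rintro rfl
      simp only [Nat.cast_zero, neg_zero] at htn
      exact lt_asymm htn ht⟩
    have h := isLeast_and_isGreatest hφ hT (T := t + n) (by linarith) (by linarith)
      (fun x hx hx0 => weightedLCT_normWeight_le hφ hT htn ht hx hx0)
      fun c hc hlt => ofReal_le_weightedLCT_normWeight hφ hT htn ht hc hlt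
    have hfun : gaugeQuotient φ (t + n) =
        fun x => ENNReal.ofReal (1 + t * ⨅ i, x i) / refinedLelong φ x := funext fun x => by
      rw [gaugeQuotient, add_sub_cancel_right]
    rwa [hfun] at h
  · have hn : NeZero n := ⟨by lia⟩
    exact isLeast_and_isGreatest hφ hT (T := k) (by exact_mod_cast hk) (by exact_mod_cast hkn)
      (fun x hx hx0 => restrictedLCT_le hφ hT hk hx hx0)
      fun c hc hlt => ofReal_le_restrictedLCT hφ hT hk hkn hc hlt
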